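/- Let $m,n\in\mathbb N$ with $m\le n$. Let $\mathrm O(m,n)=\{V\in\mathbb R^{m\times n}: VV^{\mathsf T}=I_m\}$ and, for $V\in\mathrm O(m,n)$ and $b\in\mathbb R^m$, let $\varphi_{V,b}:\mathbb R^n\to\mathbb R^m$, $\varphi_{V,b}(x)=Vx+b$; write $\varphi_{V,b}(\nu)=\nu\circ\varphi_{V,b}^{-1}$ for the pushforward of a measure. Let $\mathrm M(\mathbb R^k)$ be the set of Borel probability measures on $\mathbb R^k$. For a distance $d$ and classes $\mathcal C_k,\mathcal C_k'\subseteq \mathrm M(\mathbb R^k)$ as listed below, and for $\mu\in\mathcal C_m$, $\nu\in\mathcal C'_n$, put $$d^-(\mu,\nu)=\inf\{d(\mu,\varphi_{V,b}(\nu)): V\in\mathrm O(m,n),\ b\in\mathbb R^m\},$$ $$d^+(\mu,\nu)=\inf\{d(\alpha,\nu): \alpha\in\mathcal C_n,\ \varphi_{V,b}(\alpha)=\mu\text{ for some }V\in\mathrm O(m,n),\ b\in\mathbb R^m\}.$$ Consider any of the following cases. 1. For some $p\in[1,\infty]$, $d=\mathrm W_p$ is the $p$-Wasserstein distance for the Euclidean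 norm, $\mathrm W_p(\mu,\nu)=\inf_\gamma\|x-y\|_{L^p(\gamma)}$ over all couplings $\gamma$ of $\mu$ and $\nu$, and $\mathcal C_k=\mathcal C_k'$ consists of the measures with finite $p$-th moment (of essentially bounded Euclidean norm if $p=\infty$). 2. For some $\theta\in(0,1)$, $d(\mu,\nu)=\tfrac12 \mathrm{D}_{\mathrm{KL}}(\mu\,\|\,(1-\theta)\mu+\theta\nu)+\tfrac12 \mathrm{D}_{\mathrm{KL}}(\nu\,\|\,(1-\theta)\nu+\theta\mu)$ is the Jensen–Shannon divergence, and $\mathcal C_k=\mathcal C'_k=\mathrm M(\mathbb R^k)$. 3. $d(\mu,\nu)=\sup_A|\mu(A)-\nu(A)|$, over Borel sets $A$, is the total variation distance, and $\mathcal C_k=\mathcal C'_k=\mathrm M(\mathbb R^k)$. 4. $d(\mu,\nu)=\mathrm D_f(\mu\|\nu)=\int f\bigl(\tfrac{d\mu}{d\nu}\bigr)\,d\nu\in(-\infty,\infty]$ is the $f$-divergence of a real-valued function $f$ that is convex on $[0,\infty)$, satisfies $f(1)=0$, and is not affine on any neighbourhood of $1$; $\mathcal C_k$ consists of the measures with a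 density with respect to Lebesgue measure, and $\mathcal C'_k$ of those with a strictly positive density. Then, for all $\mu\in\mathcal C_m$ and $\nu\in\mathcal C_n'$, $d^-(\mu,\nu)=d^+(\mu,\nu)$, and this common value $\widehat d(\mu,\nu)$ is $0$ if and only if there exist $V\in\mathrm O(m,n)$ and $b\in\mathbb R^m$ with $\varphi_{V,b}(\nu)=\mu$. -/

import Mathlib

open MeasureTheory
open scoped ENNReal NNReal Matrix Topology

noncomputable section

namespace AugDist

/-- `ℝⁿ` with its Euclidean norm, Borel sigma-algebra and Lebesgue measure `volume`. -/
abbrev E (n : ℕ) : Type := EuclideanSpace ℝ (Fin n)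

/-- The Stiefel manifold `O(m,n)` of `m × n` real matrices with orthonormal rows. -/
def stiefel (m n : ℕ) : Set (Matrix (Fin m) (Fin n) ℝ) :=
  {V | V * Vᵀ = 1}

/-- The map `x ↦ V x + b` from `ℝⁿ` to `ℝᵐ`. -/
def affineProj {m n : ℕ} (V : Matrix (Fin m) (Fin n) ℝ) (b : E m) (x : E n) : E m :=
  WithLp.toLp 2 (V *ᵥ WithLp.ofLp x) + b

/-- These maps are Borel measurable, so `ν.map (affineProj V b)` is the actual pushforward. -/
theorem measurable_affineProj {m n : ℕ} (V : Matrix (Fin m) (Fin n) ℝ) (b : E m) :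
    Measurable (affineProj V b) := by
  have h : Continuous (affineProj V b) := by
    unfold affineProj
    fun_prop
  exact h.measurable

/-- The Borel probability measures on `ℝⁿ`. -/
def probs (n : ℕ) : Set (Measure (E n)) :=
  {μ | IsProbabilityMeasure μ}

/-- The Borel probability measures on `ℝⁿ` with finite `p`-th moment
(for `p = ∞`: those for which the Euclidean norm is essentially bounded). -/
def probsMoment (p : ℝ≥0∞) (n : ℕ) : Set (Measure (E n)) :=
  {μ | IsProbabilityMeasure μ ∧ MemLp (fun x : E n => x) p μ}

/-- The Borel probability measures on `ℝⁿ` that have a density with respect to Lebesgue measure. -/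
def probsDensity (n : ℕ) : Set (Measure (E n)) :=
  {μ | IsProbabilityMeasure μ ∧ ∃ g : E n → ℝ≥0, Measurable g ∧
    μ = (volume : Measure (E n)).withDensity (fun x => (g x : ℝ≥0∞))}

/-- The Borel probability measures on `ℝⁿ` that have a strictly positive density with respect to
Lebesgue measure. -/
def probsPosDensity (n : ℕ) : Set (Measure (E n)) :=
  {μ | IsProbabilityMeasure μ ∧ ∃ g : E n → ℝ≥0, Measurable g ∧ (∀ x, 0 < g x) ∧
    μ = (volume : Measure (E n)).withDensity (fun x => (g x : ℝ≥0∞))}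

/-- The projections of `ν` onto `ℝᵐ`: all probability measures that are pushforwards of `ν` under
`x ↦ V x + b`, with `V ∈ O(m,n)` and `b ∈ ℝᵐ`. -/
def projections {n : ℕ} (ν : Measure (E n)) (m : ℕ) : Set (Measure (E m)) :=
  {β | β ∈ probs m ∧ ∃ V ∈ stiefel m n, ∃ b : E m, ν.map (affineProj V b) = β}

/-- The embeddings of `μ` into `ℝⁿ` that lie in the class `C` of measures on `ℝⁿ`: all `α ∈ C` whose
pushforward under `x ↦ V x + b` is `μ` for some `V ∈ O(m,n)` and `b ∈ ℝᵐ`. -/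
def embeddings {m n : ℕ} (C : Set (Measure (E n))) (μ : Measure (E m)) : Set (Measure (E n)) :=
  {α | α ∈ C ∧ ∃ V ∈ stiefel m n, ∃ b : E m, α.map (affineProj V b) = μ}

/-- The projection distance of `d`; here `d` is a distance on measures on `ℝᵐ`. -/
def projDist {R : Type} [CompleteLattice R] {m n : ℕ} (d : Measure (E m) → Measure (E m) → R)
    (μ : Measure (E m)) (ν : Measure (E n)) : R :=
  ⨅ β ∈ projections ν m, d μ β

/-- The embedding distance of `d`, over the embeddings that lie in the class `C`;
here `d` is a distance on measures on `ℝⁿ`. -/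
def embDist {R : Type} [CompleteLattice R] {m n : ℕ} (d : Measure (E n) → Measure (E n) → R)
    (C : Set (Measure (E n))) (μ : Measure (E m)) (ν : Measure (E n)) : R :=
  ⨅ α ∈ embeddings C μ, d α ν

/-- The couplings of two probability measures: measures on the product with these marginals. -/
def couplings {n : ℕ} (μ ν : Measure (E n)) : Set (Measure (E n × E n)) :=
  {γ | IsProbabilityMeasure γ ∧ γ.map Prod.fst = μ ∧ γ.map Prod.snd = ν}

/-- The `p`-Wasserstein distance, `1 ≤ p ≤ ∞`: the infimum over all couplings `γ` of the
`L^p(γ)`-norm of `‖x - y‖` (the essential supremum for `p = ∞`). -/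
def wasserstein (p : ℝ≥0∞) {n : ℕ} (μ ν : Measure (E n)) : ℝ≥0∞ :=
  ⨅ γ ∈ couplings μ ν, eLpNorm (fun z : E n × E n => z.1 - z.2) p γ

/-- The total variation distance `sup_A |μ(A) - ν(A)|`, over Borel sets `A`. -/
def tvDist {n : ℕ} (μ ν : Measure (E n)) : ℝ≥0∞ :=
  ⨆ (A : Set (E n)) (_ : MeasurableSet A), ENNReal.ofReal |μ.real A - ν.real A|

/-- The Jensen--Shannon divergence with weight `θ ∈ (0,1)`:
`KL(μ ‖ (1-θ) μ + θ ν) / 2 + KL(ν ‖ (1-θ) ν + θ μ) / 2`. -/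
def jsDiv (θ : ℝ) {n : ℕ} (μ ν : Measure (E n)) : ℝ≥0∞ :=
  (1 / 2) * InformationTheory.klDiv μ
      (ENNReal.ofReal (1 - θ) • μ + ENNReal.ofReal θ • ν) +
    (1 / 2) * InformationTheory.klDiv ν
      (ENNReal.ofReal (1 - θ) • ν + ENNReal.ofReal θ • μ)

open Classical in
/-- The `f`-divergence `∫ f(dμ/dν) dν`. When `f` is convex on `[0,∞)`, the negative part of
`f(dμ/dν)` is always integrable, so the integral exists in `(-∞, ∞]` and is `∞` exactly if
`f(dμ/dν)` is not integrable. For measures with `μ` not absolutely continuous with respect to `ν`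
the value is set to `∞`. -/
def fDiv (f : ℝ → ℝ) {n : ℕ} (μ ν : Measure (E n)) : EReal :=
  if μ ≪ ν ∧ Integrable (fun x => f (μ.rnDeriv ν x).toReal) ν then
    ((∫ x, f (μ.rnDeriv ν x).toReal ∂ν : ℝ) : EReal)
  else ⊤

end AugDist

end

/-! For V in O(m,n) the map x ↦ Vx does not increase norms, and its adjoint `lift V` is an isometric
right inverse. Everything geometric rests on this.

The equality of the two distances is a pair of inequalities (`projDist_eq_embDist`). That projection
is at most embedding is data processing: d does not increase when both arguments are pushed forward
by φ = φ_{V,b}. The converse needs, for each φ with d(μ, φ(ν)) < ∞, embeddings α of μ with d(α, ν)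
no larger than d(μ, φ(ν)), or than the cost of a given coupling. For Wasserstein, a coupling of μ
and φ(ν) is glued to ν (`exists_coupling_lift`) and each x is moved by `lift V (y - φ x)`, a step of
length ‖y - φ x‖. For total variation and Jensen–Shannon, ν is disintegrated over φ(ν) and the same
kernel is started from μ (`exists_fiber_kernel`). For f-divergences, ν is reweighted by the density
dμ/dφ(ν) composed with φ.

For the zero criterion (`projDist_eq_zero_iff`), a small d(μ, β) forces the integrals of 1-Lipschitz
functions into [0,1] to be close. A zero infimum thus yields (V_k, b_k) with φ_k(ν) → μ weakly.
Since O(m,n) is compact and the b_k stay bounded, a subsequence converges, and its limit maps ν to μ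
(`exists_map_affineProj_eq`). -/

namespace AugDist

open Filter

/-! ### Geometry of maps with orthonormal rows. -/

section LinearAlgebra

variable {m n : ℕ}

/-- The right inverse `y ↦ Vᵀ y` of the linear part of `affineProj V b`, for `V` in `stiefel m n`. -/
def lift (V : Matrix (Fin m) (Fin n) ℝ) (y : E m) : E n :=
  WithLp.toLp 2 (Vᵀ *ᵥ WithLp.ofLp y)

theorem continuous_lift (V : Matrix (Fin m) (Fin n) ℝ) : Continuous (lift V) := by
  unfold lift
  fun_prop

theorem continuous_affineProj (V : Matrix (Fin m) (Fin n) ℝ) (b : E m) :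
    Continuous (affineProj V b) := by
  unfold affineProj
  fun_prop

theorem affineProj_add (V : Matrix (Fin m) (Fin n) ℝ) (b : E m) (x z : E n) :
    affineProj V b (x + z) = affineProj V b x + affineProj V 0 z := by
  simp [affineProj, Matrix.mulVec_add]
  abel

theorem affineProj_sub_affineProj (V : Matrix (Fin m) (Fin n) ℝ) (b : E m) (x z : E n) :
    affineProj V b x - affineProj V b z = affineProj V 0 (x - z) := by
  simp [affineProj, Matrix.mulVec_sub]

theorem affineProj_zero_lift {V : Matrix (Fin m) (Fin n) ℝ} (hV : V ∈ stiefel m n) (y : E m) :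
    affineProj V 0 (lift V y) = y := by
  have h : V * Vᵀ = 1 := hV
  simp [affineProj, lift, h]

/-- Used to translate a point x into the fibre over a prescribed y. -/
theorem affineProj_add_lift {V : Matrix (Fin m) (Fin n) ℝ} (hV : V ∈ stiefel m n) (b : E m)
    (x : E n) (y : E m) : affineProj V b (x + lift V (y - affineProj V b x)) = y := by
  rw [affineProj_add, affineProj_zero_lift hV]
  abel

/-- Adjointness yields both the isometry of `lift V` and, by Cauchy–Schwarz, the contraction
property of V. -/
theorem inner_lift (V : Matrix (Fin m) (Fin n) ℝ) (x : E n) (y : E m) :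
    inner ℝ x (lift V y) = inner ℝ (affineProj V 0 x) y := by
  simp [EuclideanSpace.inner_eq_star_dotProduct, lift, affineProj, Matrix.mulVec_transpose,
    Matrix.dotProduct_mulVec]

theorem norm_lift {V : Matrix (Fin m) (Fin n) ℝ} (hV : V ∈ stiefel m n) (y : E m) :
    ‖lift V y‖ = ‖y‖ := by
  have h : ‖lift V y‖ ^ 2 = ‖y‖ ^ 2 := by
    rw [← real_inner_self_eq_norm_sq, inner_lift, affineProj_zero_lift hV,
      real_inner_self_eq_norm_sq]
  exact (sq_eq_sq₀ (norm_nonneg _) (norm_nonneg _)).1 h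

theorem norm_affineProj_zero_le {V : Matrix (Fin m) (Fin n) ℝ} (hV : V ∈ stiefel m n) (x : E n) :
    ‖affineProj V 0 x‖ ≤ ‖x‖ := by
  have h : ‖affineProj V 0 x‖ ^ 2 ≤ ‖x‖ * ‖affineProj V 0 x‖ := by
    rw [← real_inner_self_eq_norm_sq, ← inner_lift]
    exact (real_inner_le_norm _ _).trans (by rw [norm_lift hV])
  by_contra! hlt
  nlinarith [norm_nonneg x]

end LinearAlgebra

/-! ### Compactness of the family of projections of ν under weak convergence. -/

section Compactness

variable {m n : ℕ}

/-- Rows are unit vectors, so the set is closed inside a product of intervals [-1, 1]. -/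
theorem isCompact_stiefel (m n : ℕ) :
    IsCompact {V : Fin m → Fin n → ℝ | Matrix.of V ∈ stiefel m n} := by
  have hsub : {V : Fin m → Fin n → ℝ | Matrix.of V ∈ stiefel m n} ⊆
      Set.univ.pi fun _ => Set.univ.pi fun _ => Set.Icc (-1 : ℝ) 1 := by
    intro V hV i _ j _
    have h : Matrix.of V * (Matrix.of V)ᵀ = 1 := hV
    have h1 : ∑ k, V i k * V i k = 1 := by
      simpa [Matrix.mul_apply] using congrFun (congrFun h i) i
    have h2 : V i j * V i j ≤ 1 :=
      h1 ▸ Finset.single_le_sum (f := fun k => V i k * V i k)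
        (fun k _ => mul_self_nonneg _) (Finset.mem_univ j)
    exact abs_le.1 (abs_le_one_iff_mul_self_le_one.2 h2)
  refine IsCompact.of_isClosed_subset
    (isCompact_univ_pi fun _ => isCompact_univ_pi fun _ => isCompact_Icc) ?_ hsub
  have hc : Continuous fun V : Fin m → Fin n → ℝ => Matrix.of V * (Matrix.of V)ᵀ := by
    have : Continuous fun V : Fin m → Fin n → ℝ => Matrix.of V := continuous_id
    exact this.matrix_mul this.matrix_transpose
  exact isClosed_eq hc continuous_const

theorem continuous_affineProj_params (x : E n) :
    Continuous fun p : (Fin m → Fin n → ℝ) × E m => affineProj (Matrix.of p.1) p.2 x := by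
  have : Continuous fun p : (Fin m → Fin n → ℝ) × E m => Matrix.of p.1 := continuous_fst
  unfold affineProj
  exact ((PiLp.continuous_toLp 2 _).comp (this.matrix_mulVec continuous_const)).add continuous_snd

/-- Two probability measures agree if they assign the same integral to all `1`-Lipschitz functions
with values in `[0,1]`. -/
theorem eq_of_forall_lipschitz_integral_eq {μ β : Measure (E m)} [IsProbabilityMeasure μ]
    [IsProbabilityMeasure β]
    (h : ∀ g : E m → ℝ, LipschitzWith 1 g → (∀ x, 0 ≤ g x ∧ g x ≤ 1) →
      ∫ x, g x ∂μ = ∫ x, g x ∂β) : μ = β := by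
  let μ' : ProbabilityMeasure (E m) := ⟨μ, inferInstance⟩
  let β' : ProbabilityMeasure (E m) := ⟨β, inferInstance⟩
  suffices hs : μ' = β' from congrArg Subtype.val hs
  -- A constant sequence converging weakly to β' must equal it, limits being unique.
  have ht : Tendsto (fun _ : ℕ => μ') atTop (𝓝 β') := by
    rw [tendsto_iff_forall_lipschitz_integral_tendsto]
    rintro f ⟨C, hC⟩ ⟨L, hL⟩
    have hfc := hL.continuous
    have hC0 : 0 ≤ C := dist_nonneg.trans (hC 0 0)
    have hD : 0 < 2 * C + L + 1 := by positivity
    have hb : ∀ x, |f x - f 0| ≤ C := fun x => by simpa [Real.dist_eq] using hC x 0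
    have hint : ∀ ρ : Measure (E m), IsProbabilityMeasure ρ → Integrable f ρ := fun ρ _ =>
      Integrable.of_bound hfc.aestronglyMeasurable (C + |f 0|) <| ae_of_all _ fun x => by
        have := abs_add_le (f x - f 0) (f 0)
        rw [sub_add_cancel] at this
        exact this.trans (by gcongr; exact hb x)
    -- f takes values in [f 0 - C, f 0 + C]; the divisor dominates both the range 2C and the
    -- Lipschitz constant L, and the extra 1 keeps it positive.
    have hg := h (fun x => (f x - (f 0 - C)) / (2 * C + L + 1)) ?_ ?_
    · have e : ∀ ρ : Measure (E m), IsProbabilityMeasure ρ →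
          ∫ x, (f x - (f 0 - C)) / (2 * C + L + 1) ∂ρ =
            (∫ x, f x ∂ρ - (f 0 - C)) / (2 * C + L + 1) := fun ρ _ => by
        rw [integral_div, integral_sub (hint ρ inferInstance) (integrable_const _)]
        simp
      rw [e μ inferInstance, e β inferInstance] at hg
      have : ∫ x, f x ∂μ = ∫ x, f x ∂β := by
        field_simp at hg
        linarith
      exact tendsto_const_nhds_iff.2 this
    · refine LipschitzWith.mk_one fun x y => ?_
      rw [Real.dist_eq, ← sub_div, sub_sub_sub_cancel_right, abs_div, abs_of_pos hD,
        div_le_iff₀ hD, mul_comm, ← Real.dist_eq]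
      refine (hL.dist_le_mul x y).trans ?_
      gcongr
      linarith
    · intro x
      have := abs_le.1 (hb x)
      refine ⟨div_nonneg (by linarith) hD.le, (div_le_one hD).2 ?_⟩
      have : (0 : ℝ) ≤ L := L.2
      linarith
  exact tendsto_const_nhds_iff.1 ht

theorem exists_ball_gt (μ : Measure (E m)) [IsProbabilityMeasure μ] {c : ℝ} (hc : c < 1) :
    ∃ R : ℝ, 0 ≤ R ∧ c < μ.real (Metric.closedBall 0 R) := by
  have h := tendsto_measure_iUnion_atTop (μ := μ)
    (s := fun k : ℕ => Metric.closedBall (0 : E m) (k : ℝ))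
    (fun i j hij => Metric.closedBall_subset_closedBall (by exact_mod_cast hij))
  rw [Metric.iUnion_closedBall_nat, measure_univ] at h
  have h' := (ENNReal.tendsto_toReal ENNReal.one_ne_top).comp h
  obtain ⟨k, hk⟩ := (h'.eventually (lt_mem_nhds (by simpa using hc))).exists
  exact ⟨k, by positivity, hk⟩

/-- If `φ_{V,b}(ν)` is close to `μ` in the bounded Lipschitz sense, then `b` is bounded in terms of
`μ` and `ν` only. -/
theorem exists_norm_bound (μ : Measure (E m)) (ν : Measure (E n)) [IsProbabilityMeasure μ]
    [IsProbabilityMeasure ν] : ∃ R : ℝ, ∀ V ∈ stiefel m n, ∀ b : E m,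
      (∀ g : E m → ℝ, LipschitzWith 1 g → (∀ x, 0 ≤ g x ∧ g x ≤ 1) →
        |∫ x, g x ∂μ - ∫ x, g (affineProj V b x) ∂ν| ≤ 1 / 4) → ‖b‖ ≤ R := by
  obtain ⟨r, hr0, hr⟩ := exists_ball_gt μ (c := 3 / 4) (by norm_num)
  obtain ⟨s, hs0, hs⟩ := exists_ball_gt ν (c := 3 / 4) (by norm_num)
  -- For a longer b, the ball of radius s, carrying over 3/4 of ν, is sent outside radius r + 1,
  -- where the bump g vanishes. So g has integral below 1/4 against the projection but above 3/4
  -- against μ.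
  refine ⟨r + s + 1, fun V hV b h => ?_⟩
  by_contra! hb
  let g : E m → ℝ := fun x => max 0 (min 1 (r + 1 - ‖x‖))
  have hg : LipschitzWith 1 g := by
    have : LipschitzWith 1 fun x : E m => r + 1 - ‖x‖ := by
      refine LipschitzWith.mk_one fun x y => ?_
      rw [Real.dist_eq, sub_sub_sub_cancel_left, abs_sub_comm, dist_eq_norm]
      exact abs_norm_sub_norm_le x y
    exact (this.const_min 1).const_max 0
  have hg01 : ∀ x, 0 ≤ g x ∧ g x ≤ 1 := fun x =>
    ⟨le_max_left _ _, max_le zero_le_one (min_le_left _ _)⟩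
  have hgi : ∀ {k : ℕ} (ρ : Measure (E k)) [IsProbabilityMeasure ρ] (F : E k → E m),
      Continuous F → Integrable (fun x => g (F x)) ρ := fun ρ _ F hF =>
    Integrable.of_bound (hg.continuous.comp hF).aestronglyMeasurable 1 <| ae_of_all _ fun x => by
      rw [Real.norm_eq_abs, abs_of_nonneg (hg01 _).1]
      exact (hg01 _).2
  have h1 : 3 / 4 < ∫ x, g x ∂μ := by
    refine hr.trans_le ?_
    rw [← integral_indicator_one Metric.isClosed_closedBall.measurableSet]
    refine integral_mono ((integrable_const (1 : ℝ)).indicator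
      Metric.isClosed_closedBall.measurableSet) (hgi μ id continuous_id) fun x => ?_
    by_cases hx : x ∈ Metric.closedBall (0 : E m) r
    · rw [Set.indicator_of_mem hx]
      have : ‖x‖ ≤ r := by simpa using hx
      exact le_max_of_le_right (le_min le_rfl (by rw [Pi.one_apply]; linarith))
    · rw [Set.indicator_of_notMem hx]
      exact (hg01 x).1
  have h2 : ∫ x, g (affineProj V b x) ∂ν ≤ 1 - ν.real (Metric.closedBall 0 s) := by
    rw [← probReal_compl_eq_one_sub Metric.isClosed_closedBall.measurableSet,
      ← integral_indicator_one Metric.isClosed_closedBall.measurableSet.compl]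
    refine integral_mono (hgi ν _ (continuous_affineProj V b)) ((integrable_const (1 : ℝ)).indicator
      Metric.isClosed_closedBall.measurableSet.compl) fun x => ?_
    by_cases hx : x ∈ Metric.closedBall (0 : E n) s
    · rw [Set.indicator_of_notMem (by simpa using hx)]
      have hx' : ‖x‖ ≤ s := by simpa using hx
      have h3 : affineProj V b x = affineProj V 0 x + b := by simp [affineProj]
      have h4 : r + 1 ≤ ‖affineProj V b x‖ := by
        have h5 := norm_sub_le (affineProj V b x) (affineProj V 0 x)
        rw [h3, add_sub_cancel_left, ← h3] at h5
        have h6 := norm_affineProj_zero_le hV x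
        linarith
      exact max_le le_rfl ((min_le_right _ _).trans (by linarith))
    · rw [Set.indicator_of_mem (by simpa using hx)]
      exact (hg01 _).2
  have h3 := (abs_le.1 (h g hg hg01)).2
  linarith

/-- If `μ` can be approximated, in the bounded Lipschitz sense, by the projections of `ν`, then it is
one of them. -/
theorem exists_map_affineProj_eq (μ : Measure (E m)) (ν : Measure (E n)) [IsProbabilityMeasure μ]
    [IsProbabilityMeasure ν]
    (h : ∀ ε : ℝ, 0 < ε → ∃ V ∈ stiefel m n, ∃ b : E m,
      ∀ g : E m → ℝ, LipschitzWith 1 g → (∀ x, 0 ≤ g x ∧ g x ≤ 1) →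
        |∫ x, g x ∂μ - ∫ x, g (affineProj V b x) ∂ν| ≤ ε) :
    ∃ V ∈ stiefel m n, ∃ b : E m, ν.map (affineProj V b) = μ := by
  obtain ⟨R, hR⟩ := exists_norm_bound μ ν
  -- The offset 4 makes every error at most 1/4, as the bound on b requires.
  have hpos : ∀ k : ℕ, (0 : ℝ) < 1 / (k + 4) := fun k => by positivity
  choose V hV b hb using fun k : ℕ => h (1 / (k + 4)) (hpos k)
  let u : ℕ → (Fin m → Fin n → ℝ) × E m := fun k => (V k, b k)
  have hu : ∀ k, u k ∈ {V : Fin m → Fin n → ℝ | Matrix.of V ∈ stiefel m n} ×ˢ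
      Metric.closedBall (0 : E m) R := fun k => by
    refine ⟨hV k, ?_⟩
    rw [mem_closedBall_zero_iff]
    refine hR _ (hV k) _ fun g hg hg01 => (hb k g hg hg01).trans ?_
    apply one_div_le_one_div_of_le (by norm_num)
    linarith [(Nat.cast_nonneg k : (0 : ℝ) ≤ k)]
  obtain ⟨⟨W, c⟩, hWc, ψ, hψ, hlim⟩ :=
    ((isCompact_stiefel m n).prod (isCompact_closedBall (0 : E m) R)).tendsto_subseq hu
  refine ⟨Matrix.of W, hWc.1, c, ?_⟩
  have := Measure.isProbabilityMeasure_map (μ := ν)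
    (measurable_affineProj (Matrix.of W) c).aemeasurable
  refine eq_of_forall_lipschitz_integral_eq fun g hg hg01 => ?_
  rw [integral_map (measurable_affineProj _ _).aemeasurable hg.continuous.aestronglyMeasurable]
  have t1 : Tendsto (fun k => ∫ x, g (affineProj (Matrix.of (u (ψ k)).1) (u (ψ k)).2 x) ∂ν) atTop
      (𝓝 (∫ x, g (affineProj (Matrix.of W) c x) ∂ν)) := by
    refine tendsto_integral_of_dominated_convergence (fun _ => 1) (fun k => ?_)
      (integrable_const _) (fun k => ae_of_all _ fun x => ?_) (ae_of_all _ fun x => ?_)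
    · exact (hg.continuous.comp (continuous_affineProj _ _)).aestronglyMeasurable
    · rw [Real.norm_eq_abs, abs_of_nonneg (hg01 _).1]
      exact (hg01 _).2
    · exact (hg.continuous.tendsto _).comp (((continuous_affineProj_params x).tendsto _).comp hlim)
  have t2 : Tendsto (fun k => ∫ x, g (affineProj (Matrix.of (u (ψ k)).1) (u (ψ k)).2 x) ∂ν) atTop
      (𝓝 (∫ x, g x ∂μ)) := by
    rw [tendsto_iff_dist_tendsto_zero]
    have t3 : Tendsto (fun k : ℕ => (1 : ℝ) / (k + 4)) atTop (𝓝 0) := by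
      have := (tendsto_const_nhds (x := (1 : ℝ))).div_atTop
        (tendsto_atTop_add_const_right atTop (4 : ℝ) tendsto_natCast_atTop_atTop)
      exact this
    refine squeeze_zero (fun _ => dist_nonneg) (fun k => ?_) (t3.comp hψ.tendsto_atTop)
    rw [dist_comm, Real.dist_eq]
    exact hb (ψ k) g hg hg01
  exact tendsto_nhds_unique t1 t2

end Compactness

/-! ### The two inequalities and the zero criterion, for an abstract d. -/

section InfimumDistances

variable {m n : ℕ}

theorem projDist_eq_embDist {R : Type} [CompleteLattice R]
    {dm : Measure (E m) → Measure (E m) → R} {dn : Measure (E n) → Measure (E n) → R}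
    {C : Set (Measure (E n))} {μ : Measure (E m)} {ν : Measure (E n)} [IsProbabilityMeasure ν]
    (hproj : ∀ α ∈ C, ∀ V ∈ stiefel m n, ∀ b : E m,
      dm (α.map (affineProj V b)) (ν.map (affineProj V b)) ≤ dn α ν)
    (hemb : ∀ V ∈ stiefel m n, ∀ b : E m, embDist dn C μ ν ≤ dm μ (ν.map (affineProj V b))) :
    projDist dm μ ν = embDist dn C μ ν := by
  refine le_antisymm (le_iInf₂ ?_) (le_iInf₂ ?_)
  · rintro α ⟨hα, V, hV, b, rfl⟩
    exact (iInf₂_le (ν.map (affineProj V b))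
      ⟨Measure.isProbabilityMeasure_map (measurable_affineProj V b).aemeasurable,
        V, hV, b, rfl⟩).trans (hproj α hα V hV b)
  · rintro β ⟨-, V, hV, b, rfl⟩
    exact hemb V hV b

/-- Linearity of the order turns a zero infimum into some β with d μ β < δ. Nonnegativity is a
hypothesis because `R` may be `EReal`. -/
theorem projDist_eq_zero_iff {R : Type} [CompleteLinearOrder R] [Zero R]
    {d : Measure (E m) → Measure (E m) → R} {μ : Measure (E m)} {ν : Measure (E n)}
    [IsProbabilityMeasure μ] [IsProbabilityMeasure ν]
    (hnonneg : ∀ β ∈ probs m, 0 ≤ d μ β) (hself : d μ μ = 0)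
    (hconv : ∀ ε : ℝ, 0 < ε → ∃ δ : R, 0 < δ ∧ ∀ β ∈ probs m, d μ β < δ →
      ∀ g : E m → ℝ, LipschitzWith 1 g → (∀ x, 0 ≤ g x ∧ g x ≤ 1) →
        |∫ x, g x ∂μ - ∫ x, g x ∂β| ≤ ε) :
    projDist d μ ν = 0 ↔ ∃ V ∈ stiefel m n, ∃ b : E m, ν.map (affineProj V b) = μ := by
  constructor
  · intro h0
    refine exists_map_affineProj_eq μ ν fun ε hε => ?_
    obtain ⟨δ, hδ, hd⟩ := hconv ε hε
    have hlt : projDist d μ ν < δ := h0 ▸ hδ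
    simp only [projDist, iInf_lt_iff] at hlt
    obtain ⟨_, ⟨hβ, V, hV, b, rfl⟩, hlt⟩ := hlt
    refine ⟨V, hV, b, fun g hg hg01 => ?_⟩
    rw [← integral_map (measurable_affineProj V b).aemeasurable
      hg.continuous.aestronglyMeasurable]
    exact hd _ hβ hlt g hg hg01
  · rintro ⟨V, hV, b, h⟩
    refine le_antisymm ?_ (le_iInf₂ fun β hβ => hnonneg β hβ.1)
    exact (iInf₂_le μ ⟨‹_›, V, hV, b, h⟩).trans hself.le

end InfimumDistances

/-! ### Wasserstein distances. -/

section Wasserstein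

open ProbabilityTheory

variable {m n : ℕ}

theorem wasserstein_le_of_coupling {p : ℝ≥0∞} {μ ν : Measure (E n)} {γ : Measure (E n × E n)}
    (hγ : γ ∈ couplings μ ν) :
    wasserstein p μ ν ≤ eLpNorm (fun z : E n × E n => z.1 - z.2) p γ :=
  iInf₂_le γ hγ

theorem eLpNorm_sub_map {Ω : Type*} [MeasurableSpace Ω] (p : ℝ≥0∞) {Γ : Measure Ω}
    {F : Ω → E n × E n} (hF : Measurable F) :
    eLpNorm (fun z : E n × E n => z.1 - z.2) p (Γ.map F) =
      eLpNorm (fun ω => (F ω).1 - (F ω).2) p Γ :=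
  eLpNorm_map_measure (f := F) (g := fun z : E n × E n => z.1 - z.2)
    (measurable_fst.sub measurable_snd).aestronglyMeasurable hF.aemeasurable

theorem memLp_map_iff {Ω : Type*} [MeasurableSpace Ω] {p : ℝ≥0∞} {Γ : Measure Ω} {F : Ω → E n}
    (hF : Measurable F) : MemLp (fun x : E n => x) p (Γ.map F) ↔ MemLp F p Γ :=
  memLp_map_measure_iff (f := F) (g := fun x : E n => x) aestronglyMeasurable_id hF.aemeasurable

theorem wasserstein_map_le (p : ℝ≥0∞) {V : Matrix (Fin m) (Fin n) ℝ} (hV : V ∈ stiefel m n)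
    (b : E m) (α ν : Measure (E n)) :
    wasserstein p (α.map (affineProj V b)) (ν.map (affineProj V b)) ≤ wasserstein p α ν := by
  have hφ := measurable_affineProj V b
  refine le_iInf₂ ?_
  rintro γ ⟨hγ, rfl, rfl⟩
  have hm : Measurable (Prod.map (affineProj V b) (affineProj V b)) := hφ.prodMap hφ
  refine le_trans (wasserstein_le_of_coupling
    (γ := γ.map (Prod.map (affineProj V b) (affineProj V b)))
    ⟨Measure.isProbabilityMeasure_map hm.aemeasurable, ?_, ?_⟩) ?_
  · rw [Measure.map_map measurable_fst hm, Measure.map_map hφ measurable_fst]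
    rfl
  · rw [Measure.map_map measurable_snd hm, Measure.map_map hφ measurable_snd]
    rfl
  · rw [eLpNorm_sub_map p hm]
    refine eLpNorm_mono fun z => ?_
    simp only [Prod.map_fst, Prod.map_snd, affineProj_sub_affineProj]
    exact norm_affineProj_zero_le hV _

/-- A coupling of `μ` and `φ_{V,b}(ν)` lifts to a joint law of a `ν`-distributed point `x` and a
`μ`-distributed point `y` such that `(y, φ_{V,b}(x))` has the law of the coupling. -/
theorem exists_coupling_lift {φ : E n → E m} (hφ : Measurable φ) {μ : Measure (E m)}
    {ν : Measure (E n)} [IsProbabilityMeasure ν] {γ : Measure (E m × E m)}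
    (hγ : γ ∈ couplings μ (ν.map φ)) :
    ∃ Γ : Measure (E n × E m), IsProbabilityMeasure Γ ∧ Γ.map Prod.fst = ν ∧
      Γ.map (fun z => (z.2, φ z.1)) = γ := by
  obtain ⟨hγp, -, h2⟩ := hγ
  let γs : Measure (E m × E m) := γ.map Prod.swap
  have hγs : IsProbabilityMeasure γs :=
    Measure.isProbabilityMeasure_map measurable_swap.aemeasurable
  have hfst : γs.fst = ν.map φ := by
    rw [Measure.fst, Measure.map_map measurable_fst measurable_swap, ← h2]
    rfl
  let η := γs.condKernel
  have hdis : (ν.map φ) ⊗ₘ η = γs := by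
    rw [← hfst]
    exact γs.disintegrate η
  let Γ : Measure (E n × E m) := ν ⊗ₘ (η.comap φ hφ)
  have hΓ : Γ.map (Prod.map φ id) = γs := by
    rw [← hdis]
    ext s hs
    have hm : Measurable (Prod.map φ (id : E m → E m)) := hφ.prodMap measurable_id
    rw [Measure.map_apply hm hs, Measure.compProd_apply (hm hs), Measure.compProd_apply hs,
      lintegral_map (Kernel.measurable_kernel_prodMk_left hs) hφ]
    rfl
  refine ⟨Γ, inferInstance, Measure.fst_compProd ν _, ?_⟩
  have : Measurable (Prod.map φ (id : E m → E m)) := hφ.prodMap measurable_id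
  calc Γ.map (fun z => (z.2, φ z.1)) = (Γ.map (Prod.map φ id)).map Prod.swap := by
        rw [Measure.map_map measurable_swap this]
        rfl
    _ = γ := by
        rw [hΓ, Measure.map_map measurable_swap measurable_swap]
        simp

theorem memLp_affineProj {p : ℝ≥0∞} {V : Matrix (Fin m) (Fin n) ℝ} (hV : V ∈ stiefel m n)
    (b : E m) {ν : Measure (E n)} [IsFiniteMeasure ν] (hν : MemLp (fun x : E n => x) p ν) :
    MemLp (affineProj V b) p ν := by
  have h0 : MemLp (affineProj V 0) p ν :=
    hν.mono (continuous_affineProj V 0).aestronglyMeasurable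
      (ae_of_all _ fun x => norm_affineProj_zero_le hV x)
  refine (h0.add (memLp_const b)).ae_eq (ae_of_all _ fun x => ?_)
  simp [affineProj]

theorem embDist_wasserstein_le (p : ℝ≥0∞) {V : Matrix (Fin m) (Fin n) ℝ} (hV : V ∈ stiefel m n)
    (b : E m) {μ : Measure (E m)} {ν : Measure (E n)} (hμ : μ ∈ probsMoment p m)
    (hν : ν ∈ probsMoment p n) :
    embDist (wasserstein p) (probsMoment p n) μ ν ≤
      wasserstein p μ (ν.map (affineProj V b)) := by
  have := hν.1
  have hφ := measurable_affineProj V b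
  refine le_iInf₂ fun γ hγ => ?_
  obtain ⟨Γ, hΓ, hΓν, hΓγ⟩ := exists_coupling_lift hφ hγ
  -- D moves x into the fibre over y at cost exactly ‖y - φ x‖; hence (x + D, x) is a coupling with
  -- the same cost as γ.
  let D : E n × E m → E n := fun z => lift V (z.2 - affineProj V b z.1)
  have hD : Measurable D := (continuous_lift V).measurable.comp
    (measurable_snd.sub (hφ.comp measurable_fst))
  let S : E n × E m → E n := fun z => z.1 + D z
  have hS : Measurable S := measurable_fst.add hD
  have hpair : Measurable fun z : E n × E m => (z.2, affineProj V b z.1) :=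
    measurable_snd.prodMk (hφ.comp measurable_fst)
  have hΓμ : Γ.map Prod.snd = μ := by
    rw [← hγ.2.1, ← hΓγ, Measure.map_map measurable_fst hpair]
    rfl
  have hmemD : MemLp D p Γ := by
    have h1 : MemLp (fun z : E n × E m => z.2) p Γ := by
      have h := hμ.2
      rw [← hΓμ, memLp_map_iff measurable_snd] at h
      exact h
    have h2 : MemLp (fun z : E n × E m => affineProj V b z.1) p Γ := by
      have h := memLp_affineProj hV b hν.2
      rw [← hΓν, memLp_map_measure_iff
        (continuous_affineProj V b).aestronglyMeasurable measurable_fst.aemeasurable] at h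
      exact h
    exact (h1.sub h2).mono hD.aestronglyMeasurable (ae_of_all _ fun z => (norm_lift hV _).le)
  have hmemS : MemLp S p Γ := by
    have h := hν.2
    rw [← hΓν, memLp_map_iff measurable_fst] at h
    exact MemLp.add h hmemD
  have hmem : Γ.map S ∈ embeddings (probsMoment p n) μ := by
    refine ⟨⟨Measure.isProbabilityMeasure_map hS.aemeasurable, (memLp_map_iff hS).2 hmemS⟩,
      V, hV, b, ?_⟩
    rw [Measure.map_map hφ hS, ← hΓμ]
    congr 1
    funext z
    exact affineProj_add_lift hV b z.1 z.2
  have hSf : Measurable fun z : E n × E m => (S z, z.1) := hS.prodMk measurable_fst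
  refine (iInf₂_le (Γ.map S) hmem).trans (le_trans (wasserstein_le_of_coupling
    (γ := Γ.map fun z => (S z, z.1)) ⟨Measure.isProbabilityMeasure_map hSf.aemeasurable, ?_, ?_⟩) ?_)
  · rw [Measure.map_map measurable_fst hSf]
    rfl
  · rw [Measure.map_map measurable_snd hSf, ← hΓν]
    rfl
  · rw [← hΓγ, eLpNorm_sub_map p hSf, eLpNorm_sub_map p hpair]
    refine eLpNorm_mono fun z => ?_
    simp only [S, add_sub_cancel_left]
    exact (norm_lift hV _).le

theorem wasserstein_self (p : ℝ≥0∞) (μ : Measure (E m)) [IsProbabilityMeasure μ] :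
    wasserstein p μ μ = 0 := by
  have hm : Measurable fun x : E m => (x, x) := measurable_id.prodMk measurable_id
  refine le_antisymm (le_trans (wasserstein_le_of_coupling (γ := μ.map fun x => (x, x))
    ⟨Measure.isProbabilityMeasure_map hm.aemeasurable, ?_, ?_⟩) ?_) zero_le
  · rw [Measure.map_map measurable_fst hm]
    exact Measure.map_id
  · rw [Measure.map_map measurable_snd hm]
    exact Measure.map_id
  · rw [eLpNorm_sub_map p hm]
    simp

/-- The easy half of Kantorovich duality, combined with L¹ ≤ L^p on a probability space. -/
theorem abs_integral_sub_le_wasserstein {p : ℝ≥0∞} (hp : 1 ≤ p) {μ β : Measure (E m)} {ε : ℝ}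
    (hε : 0 < ε) (h : wasserstein p μ β < ENNReal.ofReal ε) {g : E m → ℝ} (hg : LipschitzWith 1 g)
    (hg01 : ∀ x, 0 ≤ g x ∧ g x ≤ 1) : |∫ x, g x ∂μ - ∫ x, g x ∂β| ≤ ε := by
  simp only [wasserstein, iInf_lt_iff] at h
  obtain ⟨γ, ⟨hγ, rfl, rfl⟩, h⟩ := h
  have hgm := hg.continuous
  have hint : ∀ F : E m × E m → E m, Continuous F → Integrable (fun z => g (F z)) γ :=
    fun F hF => Integrable.of_bound (hgm.comp hF).aestronglyMeasurable 1 <| ae_of_all _ fun x => by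
      rw [Real.norm_eq_abs, abs_of_nonneg (hg01 _).1]
      exact (hg01 _).2
  rw [integral_map measurable_fst.aemeasurable hgm.aestronglyMeasurable,
    integral_map measurable_snd.aemeasurable hgm.aestronglyMeasurable,
    ← integral_sub (hint _ continuous_fst) (hint _ continuous_snd), ← Real.norm_eq_abs,
    ← ENNReal.ofReal_le_ofReal_iff hε.le, ofReal_norm]
  refine (enorm_integral_le_lintegral_enorm _).trans (le_trans ?_ h.le)
  refine le_trans ?_ (eLpNorm_le_eLpNorm_of_exponent_le hp
    (measurable_fst.sub measurable_snd).aestronglyMeasurable)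
  rw [eLpNorm_one_eq_lintegral_enorm]
  refine lintegral_mono fun z => ?_
  have := hg.dist_le_mul z.1 z.2
  rw [NNReal.coe_one, one_mul, dist_eq_norm, dist_eq_norm] at this
  exact enorm_le_iff_norm_le.2 this

theorem wasserstein_dist_eq {p : ℝ≥0∞} (hp : 1 ≤ p) {μ : Measure (E m)} {ν : Measure (E n)}
    (hμ : μ ∈ probsMoment p m) (hν : ν ∈ probsMoment p n) :
    projDist (wasserstein p) μ ν = embDist (wasserstein p) (probsMoment p n) μ ν ∧
      (projDist (wasserstein p) μ ν = 0 ↔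
        ∃ V ∈ stiefel m n, ∃ b : E m, ν.map (affineProj V b) = μ) := by
  have := hμ.1
  have := hν.1
  refine ⟨projDist_eq_embDist (fun α _ V hV b => wasserstein_map_le p hV b α ν)
    fun V hV b => embDist_wasserstein_le p hV b hμ hν,
    projDist_eq_zero_iff (fun _ _ => zero_le) (wasserstein_self p μ) fun ε hε =>
      ⟨ENNReal.ofReal ε, ENNReal.ofReal_pos.2 hε, fun β _ h g hg hg01 =>
        abs_integral_sub_le_wasserstein hp hε h hg hg01⟩⟩

end Wasserstein

/-! ### Disintegration along the fibres of a projection. -/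

section Fibers

open ProbabilityTheory

variable {m n : ℕ}

/-- Disintegration of `ν` along `φ_{V,b}`, with the conditional laws transported to any fiber: the
law `ν` is obtained from its projection `β` by a Markov kernel and a map over `φ_{V,b}`, and replacing
`β` by any other `ρ` in this construction gives a measure whose projection is `ρ`. -/
theorem exists_fiber_kernel {V : Matrix (Fin m) (Fin n) ℝ} (hV : V ∈ stiefel m n) (b : E m)
    (ν : Measure (E n)) [IsProbabilityMeasure ν] :
    ∃ (κ : Kernel (E m) (E n)) (T : E m × E n → E n), IsMarkovKernel κ ∧ Measurable T ∧
      ((ν.map (affineProj V b)) ⊗ₘ κ).map T = ν ∧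
      ∀ ρ : Measure (E m), IsProbabilityMeasure ρ →
        ((ρ ⊗ₘ κ).map T).map (affineProj V b) = ρ := by
  have hφ := measurable_affineProj V b
  have hJ : Measurable fun x : E n => (affineProj V b x, x) := hφ.prodMk measurable_id
  let J : Measure (E m × E n) := ν.map fun x => (affineProj V b x, x)
  have hJp : IsProbabilityMeasure J := Measure.isProbabilityMeasure_map hJ.aemeasurable
  have hfst : J.fst = ν.map (affineProj V b) := by
    rw [Measure.fst, Measure.map_map measurable_fst hJ]
    rfl
  -- T translates the second coordinate into the fibre over the first, so φ ∘ T is the first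
  -- coordinate. It returns x on each pair (φ x, x), which is why ν is recovered.
  let T : E m × E n → E n := fun z => z.2 + lift V (z.1 - affineProj V b z.2)
  have hT : Measurable T := measurable_snd.add ((continuous_lift V).measurable.comp
    (measurable_fst.sub (hφ.comp measurable_snd)))
  refine ⟨J.condKernel, T, inferInstance, hT, ?_, fun ρ _ => ?_⟩
  · rw [← hfst, J.disintegrate J.condKernel, Measure.map_map hT hJ]
    have : T ∘ (fun x : E n => (affineProj V b x, x)) = id := by
      funext x
      simp [T, lift]
    rw [this, Measure.map_id]
  · rw [Measure.map_map hφ hT]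
    have : affineProj V b ∘ T = Prod.fst := by
      funext z
      exact affineProj_add_lift hV b z.2 z.1
    rw [this]
    exact Measure.fst_compProd ρ _

end Fibers

/-! ### Total variation. -/

section TotalVariation

open ProbabilityTheory

variable {m n : ℕ}

theorem le_tvDist (μ ν : Measure (E n)) {A : Set (E n)} (hA : MeasurableSet A) :
    ENNReal.ofReal |μ.real A - ν.real A| ≤ tvDist μ ν :=
  le_iSup₂ (f := fun (A : Set (E n)) (_ : MeasurableSet A) =>
    ENNReal.ofReal |μ.real A - ν.real A|) A hA

theorem tvDist_map_le {φ : E n → E m} (hφ : Measurable φ) (α ν : Measure (E n)) :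
    tvDist (α.map φ) (ν.map φ) ≤ tvDist α ν := by
  refine iSup₂_le fun A hA => ?_
  rw [map_measureReal_apply hφ hA, map_measureReal_apply hφ hA]
  exact le_tvDist α ν (hφ hA)

theorem tvDist_self (μ : Measure (E n)) : tvDist μ μ = 0 := by
  simp [tvDist]

theorem integrable_of_mem_Icc {Ω : Type*} [MeasurableSpace Ω] {ρ : Measure Ω} [IsFiniteMeasure ρ]
    {h : Ω → ℝ} (hm : Measurable h) (h01 : ∀ x, 0 ≤ h x ∧ h x ≤ 1) : Integrable h ρ :=
  Integrable.of_bound hm.aestronglyMeasurable 1 <| ae_of_all _ fun x => by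
    rw [Real.norm_eq_abs, abs_of_nonneg (h01 _).1]
    exact (h01 _).2

/-- S is the positive set of a Hahn decomposition of μ - β: among functions into [0,1], its
indicator maximises the difference of integrals. -/
theorem exists_integral_sub_le {Ω : Type*} [MeasurableSpace Ω] (μ β : Measure Ω)
    [IsProbabilityMeasure μ] [IsProbabilityMeasure β] :
    ∃ S : Set Ω, MeasurableSet S ∧ ∀ h : Ω → ℝ, Measurable h → (∀ x, 0 ≤ h x ∧ h x ≤ 1) →
      ∫ x, h x ∂μ - ∫ x, h x ∂β ≤ μ.real S - β.real S := by
  obtain ⟨S, hS, h1, h2⟩ := hahn_decomposition μ β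
  refine ⟨S, hS, fun h hm h01 => ?_⟩
  have hi : ∀ (ρ : Measure Ω) [IsFiniteMeasure ρ], Integrable h ρ := fun ρ _ =>
    integrable_of_mem_Icc hm h01
  have hle1 : β.restrict S ≤ μ.restrict S := by
    refine Measure.le_iff.2 fun A hA => ?_
    rw [Measure.restrict_apply hA, Measure.restrict_apply hA]
    exact h1 _ (hA.inter hS) Set.inter_subset_right
  have hle2 : μ.restrict Sᶜ ≤ β.restrict Sᶜ := by
    refine Measure.le_iff.2 fun A hA => ?_
    rw [Measure.restrict_apply hA, Measure.restrict_apply hA]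
    exact h2 _ (hA.inter hS.compl) Set.inter_subset_right
  have i1 : ∫ x in S, (1 - h x) ∂β ≤ ∫ x in S, (1 - h x) ∂μ :=
    integral_mono_measure hle1 (ae_of_all _ fun x => sub_nonneg.2 (h01 x).2)
      ((integrable_const _).sub (hi _))
  have i2 : ∫ x in Sᶜ, h x ∂μ ≤ ∫ x in Sᶜ, h x ∂β :=
    integral_mono_measure hle2 (ae_of_all _ fun x => (h01 x).1) (hi _)
  rw [integral_sub (integrable_const _) (hi _), integral_sub (integrable_const _) (hi _)] at i1
  simp only [integral_const, smul_eq_mul, mul_one, measureReal_restrict_apply_univ] at i1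
  rw [← integral_add_compl hS (hi μ), ← integral_add_compl hS (hi β)]
  linarith

theorem ofReal_abs_integral_sub_le_tvDist (μ β : Measure (E m)) [IsProbabilityMeasure μ]
    [IsProbabilityMeasure β] {h : E m → ℝ} (hm : Measurable h) (h01 : ∀ x, 0 ≤ h x ∧ h x ≤ 1) :
    ENNReal.ofReal |∫ x, h x ∂μ - ∫ x, h x ∂β| ≤ tvDist μ β := by
  obtain ⟨S, hS, hle⟩ := exists_integral_sub_le μ β
  refine le_trans (ENNReal.ofReal_le_ofReal ?_) (le_tvDist μ β hS)
  refine abs_le.2 ⟨?_, (hle h hm h01).trans (le_abs_self _)⟩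
  have h2 := hle (fun x => 1 - h x) (measurable_const.sub hm)
    fun x => ⟨sub_nonneg.2 (h01 x).2, by linarith [(h01 x).1]⟩
  rw [integral_sub (integrable_const _) (integrable_of_mem_Icc hm h01),
    integral_sub (integrable_const _) (integrable_of_mem_Icc hm h01)] at h2
  simp only [integral_const, smul_eq_mul, mul_one, probReal_univ] at h2
  linarith [le_abs_self (μ.real S - β.real S)]

theorem tvDist_compProd_map_le (μ β : Measure (E m)) [IsProbabilityMeasure μ]
    [IsProbabilityMeasure β] (κ : Kernel (E m) (E n)) [IsMarkovKernel κ] {T : E m × E n → E n}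
    (hT : Measurable T) : tvDist ((μ ⊗ₘ κ).map T) ((β ⊗ₘ κ).map T) ≤ tvDist μ β := by
  refine iSup₂_le fun A hA => ?_
  -- The mass of A is the integral of h against the base measure, and h does not depend on that
  -- measure.
  let h : E m → ℝ := fun y => (κ y).real (Prod.mk y ⁻¹' (T ⁻¹' A))
  have hm : Measurable h := (Kernel.measurable_kernel_prodMk_left (hT hA)).ennreal_toReal
  have e : ∀ ρ : Measure (E m), IsProbabilityMeasure ρ →
      ((ρ ⊗ₘ κ).map T).real A = ∫ y, h y ∂ρ := fun ρ _ => by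
    rw [map_measureReal_apply hT hA, measureReal_def, Measure.compProd_apply (hT hA)]
    exact (integral_toReal (Kernel.measurable_kernel_prodMk_left (hT hA)).aemeasurable
      (ae_of_all _ fun y => measure_lt_top _ _)).symm
  rw [e μ inferInstance, e β inferInstance]
  exact ofReal_abs_integral_sub_le_tvDist μ β hm fun y => ⟨measureReal_nonneg, measureReal_le_one⟩

theorem tvDist_dist_eq {μ : Measure (E m)} {ν : Measure (E n)} (hμ : μ ∈ probs m)
    (hν : ν ∈ probs n) :
    projDist tvDist μ ν = embDist tvDist (probs n) μ ν ∧
      (projDist tvDist μ ν = 0 ↔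
        ∃ V ∈ stiefel m n, ∃ b : E m, ν.map (affineProj V b) = μ) := by
  have : IsProbabilityMeasure μ := hμ
  have : IsProbabilityMeasure ν := hν
  refine ⟨projDist_eq_embDist
    (fun α _ V hV b => tvDist_map_le (measurable_affineProj V b) α ν) fun V hV b => ?_,
    projDist_eq_zero_iff (fun _ _ => zero_le) (tvDist_self μ) fun ε hε =>
      ⟨ENNReal.ofReal ε, ENNReal.ofReal_pos.2 hε, fun β hβ h g hg hg01 => ?_⟩⟩
  · obtain ⟨κ, T, hκ, hT, h1, h2⟩ := exists_fiber_kernel hV b ν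
    have := Measure.isProbabilityMeasure_map (μ := ν) (measurable_affineProj V b).aemeasurable
    have h3 := tvDist_compProd_map_le μ (ν.map (affineProj V b)) κ hT
    rw [h1] at h3
    exact (iInf₂_le _ ⟨Measure.isProbabilityMeasure_map hT.aemeasurable,
      V, hV, b, h2 μ inferInstance⟩).trans h3
  · have : IsProbabilityMeasure β := hβ
    rw [← ENNReal.ofReal_le_ofReal_iff hε.le]
    exact (ofReal_abs_integral_sub_le_tvDist μ β hg.continuous.measurable hg01).trans h.le

end TotalVariation

/-! ### Small divergence forces small total variation. -/

section Generators

open Set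

/-- The values of a convex function at `1 + sε` and at a point beyond it, as seen from its zero `1`. -/
theorem mul_le_of_convexOn_of_zero_at_one {g : ℝ → ℝ} (hg : ConvexOn ℝ (Ici 0) g) (h1 : g 1 = 0)
    {s ε r : ℝ} (hε : 0 < ε) (hr : 0 ≤ r) (hlt : ε < s * (r - 1)) (hs : s * s = 1) :
    s * (r - 1) * g (1 + s * ε) ≤ ε * g r := by
  have hd : 0 < s * (r - 1) := hε.trans hlt
  have h := hg.2 (mem_Ici.2 zero_le_one) (mem_Ici.2 hr)
    (sub_nonneg.2 ((div_le_one hd).2 hlt.le)) (div_pos hε hd).le (sub_add_cancel _ _)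
  -- With s = ±1 selecting the side, 1 + sε lies between 1 and r.
  have e : (1 - ε / (s * (r - 1))) • (1 : ℝ) + (ε / (s * (r - 1))) • r = 1 + s * ε := by
    have hs0 : s ≠ 0 := left_ne_zero_of_mul hd.ne'
    have hr0 : r - 1 ≠ 0 := right_ne_zero_of_mul hd.ne'
    simp only [smul_eq_mul]
    field_simp
    linear_combination (-ε * (r - 1)) * hs
  rw [e, h1, smul_zero, zero_add, smul_eq_mul] at h
  calc s * (r - 1) * g (1 + s * ε) ≤ s * (r - 1) * (ε / (s * (r - 1)) * g r) := by gcongr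
    _ = ε * g r := by rw [← mul_assoc, mul_div_cancel₀ _ hd.ne']

/-- A nonnegative convex function with `g 1 = 0` that is positive on one side of `1` controls the
distance to `1` on that side, up to an arbitrarily small error. -/
theorem exists_sign_mul_le {g : ℝ → ℝ} (hg : ConvexOn ℝ (Ici 0) g) (h0 : ∀ t, 0 ≤ g t)
    (h1 : g 1 = 0) (hne : (∀ t, 0 ≤ t → t < 1 → 0 < g t) ∨ ∀ t, 1 < t → 0 < g t) :
    ∃ s : ℝ, s * s = 1 ∧ ∀ ε : ℝ, 0 < ε → ∃ C : ℝ, 0 ≤ C ∧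
      ∀ r : ℝ, 0 ≤ r → s * (r - 1) ≤ ε + C * g r := by
  have key : ∀ s ε : ℝ, s * s = 1 → 0 < ε → 0 < g (1 + s * ε) →
      ∀ r : ℝ, 0 ≤ r → s * (r - 1) ≤ ε + ε / g (1 + s * ε) * g r := by
    intro s ε hs hε hp r hr
    rcases le_or_gt (s * (r - 1)) ε with hle | hlt
    · have := h0 r
      exact hle.trans (le_add_of_nonneg_right (by positivity))
    · have h := mul_le_of_convexOn_of_zero_at_one hg h1 hε hr hlt hs
      rw [← le_div_iff₀ hp] at h
      calc s * (r - 1) ≤ ε * g r / g (1 + s * ε) := h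
        _ = ε / g (1 + s * ε) * g r := by ring
        _ ≤ _ := le_add_of_nonneg_left hε.le
  rcases hne with hne | hne
  · refine ⟨-1, by norm_num, fun ε hε => ?_⟩
    -- On the left side 1 - r ≤ 1, so ε ≥ 1 is trivial; otherwise 1 - ε stays in the domain of
    -- convexity.
    rcases le_or_gt 1 ε with hle | hlt
    · exact ⟨0, le_rfl, fun r hr => by linarith⟩
    · have hp : 0 < g (1 + -1 * ε) := hne _ (by linarith) (by linarith)
      exact ⟨ε / g (1 + -1 * ε), by positivity, key (-1) ε (by norm_num) hε hp⟩
  · refine ⟨1, by norm_num, fun ε hε => ?_⟩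
    have hp : 0 < g (1 + 1 * ε) := hne _ (by linarith)
    exact ⟨ε / g (1 + 1 * ε), by positivity, key 1 ε (by norm_num) hε hp⟩

/-- If the divergence generated by `g` is small, then so is the total variation distance. -/
theorem exists_forall_abs_integral_sub_le {g : ℝ → ℝ} (hgm : Measurable g)
    (hg : ConvexOn ℝ (Ici 0) g) (h0 : ∀ t, 0 ≤ g t) (h1 : g 1 = 0)
    (hne : (∀ t, 0 ≤ t → t < 1 → 0 < g t) ∨ ∀ t, 1 < t → 0 < g t) {ε : ℝ} (hε : 0 < ε) :
    ∃ δ : ℝ≥0∞, 0 < δ ∧ ∀ {Ω : Type} [MeasurableSpace Ω] (μ β : Measure Ω)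
      [IsProbabilityMeasure μ] [IsProbabilityMeasure β], μ ≪ β →
      ∫⁻ x, ENNReal.ofReal (g (μ.rnDeriv β x).toReal) ∂β < δ →
      ∀ h : Ω → ℝ, Measurable h → (∀ x, 0 ≤ h x ∧ h x ≤ 1) →
        |∫ x, h x ∂μ - ∫ x, h x ∂β| ≤ ε := by
  obtain ⟨s, hs, hC⟩ := exists_sign_mul_le hg h0 h1 hne
  obtain ⟨C, hC0, hC⟩ := hC (ε / 2) (half_pos hε)
  have hδ : 0 < ε / (2 * (C + 1)) := by positivity
  refine ⟨ENNReal.ofReal (ε / (2 * (C + 1))), ENNReal.ofReal_pos.2 hδ, ?_⟩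
  intro Ω _ μ β _ _ hμβ hlt
  have hrm : Measurable fun x => (μ.rnDeriv β x).toReal :=
    (Measure.measurable_rnDeriv μ β).ennreal_toReal
  have hgi : Integrable (fun x => g (μ.rnDeriv β x).toReal) β :=
    (lintegral_ofReal_ne_top_iff_integrable (hgm.comp hrm).aestronglyMeasurable
      (ae_of_all _ fun x => h0 _)).1 hlt.ne_top
  have hD : ∫ x, g (μ.rnDeriv β x).toReal ∂β ≤ ε / (2 * (C + 1)) := by
    rw [← ofReal_integral_eq_lintegral_ofReal hgi (ae_of_all _ fun x => h0 _),
      ENNReal.ofReal_lt_ofReal_iff hδ] at hlt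
    exact hlt.le
  have hD0 : 0 ≤ ∫ x, g (μ.rnDeriv β x).toReal ∂β := integral_nonneg fun x => h0 _
  have hCD : C * ∫ x, g (μ.rnDeriv β x).toReal ∂β ≤ ε / 2 := by
    calc C * ∫ x, g (μ.rnDeriv β x).toReal ∂β ≤ (C + 1) * (ε / (2 * (C + 1))) := by
          gcongr
          linarith
      _ = ε / 2 := by field_simp
  have hone : ∀ h : Ω → ℝ, Measurable h → (∀ x, 0 ≤ h x ∧ h x ≤ 1) →
      s * (∫ x, h x ∂μ - ∫ x, h x ∂β) ≤ ε := by
    intro h hm h01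
    have hhi : Integrable h β := integrable_of_mem_Icc hm h01
    have hri : Integrable (fun x => (μ.rnDeriv β x).toReal • h x) β :=
      (integrable_rnDeriv_smul_iff hμβ).2 (integrable_of_mem_Icc hm h01)
    rw [← integral_rnDeriv_smul hμβ, ← integral_sub hri hhi]
    have : ∫ x, s * ((μ.rnDeriv β x).toReal • h x - h x) ∂β ≤
        ∫ x, (ε / 2 + C * g (μ.rnDeriv β x).toReal) ∂β := by
      refine integral_mono ((hri.sub hhi).const_mul s)
        ((integrable_const _).add (hgi.const_mul C)) fun x => ?_
      have hx := hC (μ.rnDeriv β x).toReal ENNReal.toReal_nonneg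
      have hp : 0 ≤ ε / 2 + C * g (μ.rnDeriv β x).toReal := by
        have := h0 (μ.rnDeriv β x).toReal
        positivity
      calc s * ((μ.rnDeriv β x).toReal • h x - h x) = s * ((μ.rnDeriv β x).toReal - 1) * h x := by
            rw [smul_eq_mul]
            ring
        _ ≤ (ε / 2 + C * g (μ.rnDeriv β x).toReal) * h x :=
            mul_le_mul_of_nonneg_right hx (h01 x).1
        _ ≤ _ := mul_le_of_le_one_right hp (h01 x).2
    rw [integral_const_mul, integral_add (integrable_const _) (hgi.const_mul C),
      integral_const_mul, integral_const, probReal_univ, one_smul] at this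
    linarith
  intro h hm h01
  -- Control on one side of 1 suffices: both masses are one, so passing to 1 - h reverses the sign
  -- of the difference.
  have a1 := hone h hm h01
  have a2 := hone (fun x => 1 - h x) (measurable_const.sub hm)
    fun x => ⟨sub_nonneg.2 (h01 x).2, by linarith [(h01 x).1]⟩
  rw [integral_sub (integrable_const _) (integrable_of_mem_Icc hm h01),
    integral_sub (integrable_const _) (integrable_of_mem_Icc hm h01)] at a2
  simp only [integral_const, smul_eq_mul, mul_one, probReal_univ] at a2
  rcases mul_self_eq_one_iff.1 hs with rfl | rfl <;> exact abs_le.2 ⟨by linarith, by linarith⟩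

end Generators

/-! ### Jensen–Shannon divergence. -/

section JensenShannon

open ProbabilityTheory InformationTheory

variable {m n : ℕ}

theorem jsDiv_map_le (θ : ℝ) {φ : E n → E m} (hφ : Measurable φ) (α ν : Measure (E n))
    [IsProbabilityMeasure α] [IsProbabilityMeasure ν] :
    jsDiv θ (α.map φ) (ν.map φ) ≤ jsDiv θ α ν := by
  have key : ∀ ρ σ : Measure (E n), IsProbabilityMeasure ρ → IsProbabilityMeasure σ →
      klDiv (ρ.map φ) (ENNReal.ofReal (1 - θ) • ρ.map φ + ENNReal.ofReal θ • σ.map φ) ≤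
        klDiv ρ (ENNReal.ofReal (1 - θ) • ρ + ENNReal.ofReal θ • σ) := fun ρ σ _ _ => by
    have : IsFiniteMeasure (ENNReal.ofReal (1 - θ) • ρ) :=
      ρ.smul_finite ENNReal.ofReal_ne_top
    have : IsFiniteMeasure (ENNReal.ofReal θ • σ) := σ.smul_finite ENNReal.ofReal_ne_top
    rw [← Measure.map_smul, ← Measure.map_smul, ← Measure.map_add _ _ hφ]
    exact klDiv_map_le _ _ hφ
  unfold jsDiv
  gcongr
  · exact key α ν inferInstance inferInstance
  · exact key ν α inferInstance inferInstance

/-- Mixtures commute with composition by κ. A common kernel leaves each KL term unchanged, and T can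
only decrease it. -/
theorem jsDiv_compProd_map_le (θ : ℝ) (μ β : Measure (E m)) [IsProbabilityMeasure μ]
    [IsProbabilityMeasure β] (κ : Kernel (E m) (E n)) [IsMarkovKernel κ] {T : E m × E n → E n}
    (hT : Measurable T) : jsDiv θ ((μ ⊗ₘ κ).map T) ((β ⊗ₘ κ).map T) ≤ jsDiv θ μ β := by
  have key : ∀ ρ σ : Measure (E m), IsProbabilityMeasure ρ → IsProbabilityMeasure σ →
      klDiv ((ρ ⊗ₘ κ).map T) (ENNReal.ofReal (1 - θ) • (ρ ⊗ₘ κ).map T +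
          ENNReal.ofReal θ • (σ ⊗ₘ κ).map T) ≤
        klDiv ρ (ENNReal.ofReal (1 - θ) • ρ + ENNReal.ofReal θ • σ) := fun ρ σ _ _ => by
    have : IsFiniteMeasure (ENNReal.ofReal (1 - θ) • ρ) :=
      ρ.smul_finite ENNReal.ofReal_ne_top
    have : IsFiniteMeasure (ENNReal.ofReal θ • σ) := σ.smul_finite ENNReal.ofReal_ne_top
    rw [← Measure.map_smul, ← Measure.map_smul, ← Measure.map_add _ _ hT,
      ← Measure.compProd_smul_left, ← Measure.compProd_smul_left, ← Measure.compProd_add_left]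
    exact (klDiv_map_le _ _ hT).trans_eq (klDiv_compProd_left _ _ κ)
  unfold jsDiv
  gcongr
  · exact key μ β inferInstance inferInstance
  · exact key β μ inferInstance inferInstance

theorem ofReal_smul_add_ofReal_smul {Ω : Type*} [MeasurableSpace Ω] {θ : ℝ} (h0 : 0 < θ)
    (h1 : θ < 1) (μ : Measure Ω) :
    ENNReal.ofReal (1 - θ) • μ + ENNReal.ofReal θ • μ = μ := by
  rw [← add_smul, ← ENNReal.ofReal_add (sub_nonneg.2 h1.le) h0.le]
  simp

theorem jsDiv_self {θ : ℝ} (h0 : 0 < θ) (h1 : θ < 1) (μ : Measure (E n))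
    [IsProbabilityMeasure μ] : jsDiv θ μ μ = 0 := by
  simp [jsDiv, ofReal_smul_add_ofReal_smul h0 h1]

theorem exists_forall_abs_integral_sub_le_of_jsDiv_lt {θ : ℝ} (h0 : 0 < θ) (h1 : θ < 1) {ε : ℝ}
    (hε : 0 < ε) : ∃ δ : ℝ≥0∞, 0 < δ ∧ ∀ μ β : Measure (E m), IsProbabilityMeasure μ →
      IsProbabilityMeasure β → jsDiv θ μ β < δ →
        ∀ h : E m → ℝ, Measurable h → (∀ x, 0 ≤ h x ∧ h x ≤ 1) →
          |∫ x, h x ∂μ - ∫ x, h x ∂β| ≤ ε := by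
  -- Truncation makes the generator nonnegative on all of ℝ without changing it at densities.
  let g : ℝ → ℝ := fun t => klFun (max t 0)
  have hcongr : ∀ t, 0 ≤ t → g t = klFun t := fun t ht => by simp [g, ht]
  have hgconv : ConvexOn ℝ (Set.Ici 0) g :=
    convexOn_klFun.congr fun t ht => (hcongr t ht).symm
  have hpos : ∀ t, 0 ≤ t → t < 1 → 0 < g t := fun t ht ht1 => by
    rw [hcongr t ht]
    exact (klFun_nonneg ht).lt_of_ne fun h => ht1.ne ((klFun_eq_zero_iff ht).1 h.symm)
  obtain ⟨δ, hδ, hd⟩ := exists_forall_abs_integral_sub_le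
    (g := g) (measurable_klFun.comp (measurable_id.max measurable_const)) hgconv
    (fun t => klFun_nonneg (le_max_right _ _))
    (by rw [hcongr 1 zero_le_one, klFun_one]) (Or.inl hpos) (mul_pos h0 hε)
  refine ⟨1 / 2 * δ, ENNReal.mul_pos (by simp) hδ.ne', fun μ β _ _ hlt h hm h01 => ?_⟩
  let ρ : Measure (E m) := ENNReal.ofReal (1 - θ) • μ + ENNReal.ofReal θ • β
  have hθ : ENNReal.ofReal (1 - θ) + ENNReal.ofReal θ = 1 := by
    rw [← ENNReal.ofReal_add (sub_nonneg.2 h1.le) h0.le]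
    simp
  have hρ : IsProbabilityMeasure ρ := ⟨by simp [ρ, hθ]⟩
  have hac : μ ≪ ρ := (Measure.absolutelyContinuous_smul
    (ENNReal.ofReal_pos.2 (sub_pos.2 h1)).ne').add_right _
  have hkl : klDiv μ ρ < δ := by
    by_contra! hle
    refine hlt.not_ge (le_trans ?_ le_self_add)
    gcongr
  rw [klDiv_eq_lintegral_klFun_of_ac hac] at hkl
  have hb := hd μ ρ hac (by simpa only [hcongr _ ENNReal.toReal_nonneg] using hkl) h hm h01
  have hi : ∀ (σ : Measure (E m)) [IsFiniteMeasure σ], Integrable h σ := fun σ _ =>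
    integrable_of_mem_Icc hm h01
  have e : ∫ x, h x ∂ρ = (1 - θ) * ∫ x, h x ∂μ + θ * ∫ x, h x ∂β := by
    rw [integral_add_measure ((hi μ).smul_measure ENNReal.ofReal_ne_top)
      ((hi β).smul_measure ENNReal.ofReal_ne_top), integral_smul_measure, integral_smul_measure,
      ENNReal.toReal_ofReal (sub_nonneg.2 h1.le), ENNReal.toReal_ofReal h0.le]
    rfl
  -- Comparing μ with the mixture ρ shrinks the difference by θ, hence the tolerance θε above.
  have e' : ∫ x, h x ∂μ - ∫ x, h x ∂ρ = θ * (∫ x, h x ∂μ - ∫ x, h x ∂β) := by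
    rw [e]
    ring
  rw [e', abs_mul, abs_of_pos h0] at hb
  exact le_of_mul_le_mul_left hb h0

theorem jsDiv_dist_eq {θ : ℝ} (h0 : 0 < θ) (h1 : θ < 1) {μ : Measure (E m)} {ν : Measure (E n)}
    (hμ : μ ∈ probs m) (hν : ν ∈ probs n) :
    projDist (jsDiv θ) μ ν = embDist (jsDiv θ) (probs n) μ ν ∧
      (projDist (jsDiv θ) μ ν = 0 ↔
        ∃ V ∈ stiefel m n, ∃ b : E m, ν.map (affineProj V b) = μ) := by
  have : IsProbabilityMeasure μ := hμ
  have : IsProbabilityMeasure ν := hν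
  refine ⟨projDist_eq_embDist (fun α hα V hV b => ?_) fun V hV b => ?_,
    projDist_eq_zero_iff (fun _ _ => zero_le) (jsDiv_self h0 h1 μ) fun ε hε => ?_⟩
  · have : IsProbabilityMeasure α := hα
    exact jsDiv_map_le θ (measurable_affineProj V b) α ν
  · obtain ⟨κ, T, hκ, hT, e1, e2⟩ := exists_fiber_kernel hV b ν
    have := Measure.isProbabilityMeasure_map (μ := ν) (measurable_affineProj V b).aemeasurable
    have h3 := jsDiv_compProd_map_le θ μ (ν.map (affineProj V b)) κ hT
    rw [e1] at h3
    exact (iInf₂_le _ ⟨Measure.isProbabilityMeasure_map hT.aemeasurable,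
      V, hV, b, e2 μ inferInstance⟩).trans h3
  · obtain ⟨δ, hδ, hd⟩ := exists_forall_abs_integral_sub_le_of_jsDiv_lt (m := m) h0 h1 hε
    exact ⟨δ, hδ, fun β hβ h g hg hg01 =>
      hd μ β inferInstance hβ h g hg.continuous.measurable hg01⟩

end JensenShannon

/-! ### Data processing for convex generators. -/

section DataProcessing

open Set Filter

variable {Ω Ω' : Type*} [MeasurableSpace Ω] [MeasurableSpace Ω']

/-- Data processing on preimages of measurable sets, for generators that are continuous at `0`. -/
theorem setLIntegral_comp_rnDeriv_map_le {g : ℝ → ℝ} (hgm : Measurable g)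
    (hg : ConvexOn ℝ (Ici 0) g) (hc : ContinuousWithinAt g (Ici 0) 0) (h0 : ∀ t, 0 ≤ g t)
    {μ ν : Measure Ω} [IsFiniteMeasure μ] [IsFiniteMeasure ν] (hμν : μ ≪ ν) {φ : Ω → Ω'}
    (hφ : Measurable φ) (hi : Integrable (fun x => g (μ.rnDeriv ν x).toReal) ν) {B : Set Ω'}
    (hB : MeasurableSet B) :
    ∫⁻ x in φ ⁻¹' B, ENNReal.ofReal (g ((μ.map φ).rnDeriv (ν.map φ) (φ x)).toReal) ∂ν ≤
      ∫⁻ x in φ ⁻¹' B, ENNReal.ofReal (g (μ.rnDeriv ν x).toReal) ∂ν := by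
  -- Conditional Jensen: the density of the pushforwards, composed with φ, is the conditional
  -- expectation of dμ/dν given φ.
  have hle := hg.comp_rnDeriv_map_le hμν hφ hgm.stronglyMeasurable hc hi
  calc ∫⁻ x in φ ⁻¹' B, ENNReal.ofReal (g ((μ.map φ).rnDeriv (ν.map φ) (φ x)).toReal) ∂ν
      ≤ ∫⁻ x in φ ⁻¹' B, ENNReal.ofReal ((ν[fun x => g (μ.rnDeriv ν x).toReal |
          MeasurableSpace.comap φ inferInstance]) x) ∂ν :=
        lintegral_mono_ae <| ae_restrict_of_ae <| hle.mono fun x hx => ENNReal.ofReal_le_ofReal hx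
    _ = ENNReal.ofReal (∫ x in φ ⁻¹' B, (ν[fun x => g (μ.rnDeriv ν x).toReal |
          MeasurableSpace.comap φ inferInstance]) x ∂ν) :=
        (ofReal_integral_eq_lintegral_ofReal integrable_condExp.integrableOn
          (ae_restrict_of_ae (condExp_nonneg (ae_of_all _ fun x => h0 _)))).symm
    _ = ENNReal.ofReal (∫ x in φ ⁻¹' B, g (μ.rnDeriv ν x).toReal ∂ν) := by
        rw [setIntegral_condExp hφ.comap_le hi ⟨B, hB, rfl⟩]
    _ = _ := ofReal_integral_eq_lintegral_ofReal hi.integrableOn (ae_of_all _ fun x => h0 _)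

/-- **Data processing inequality** for the divergence generated by a nonnegative convex function,
which may be discontinuous at `0`. -/
theorem lintegral_comp_rnDeriv_map_le {g : ℝ → ℝ} (hgm : Measurable g)
    (hg : ConvexOn ℝ (Ici 0) g) (h0 : ∀ t, 0 ≤ g t) (h1 : g 1 = 0) {μ ν : Measure Ω}
    [IsFiniteMeasure μ] [IsFiniteMeasure ν] (hμν : μ ≪ ν) {φ : Ω → Ω'} (hφ : Measurable φ) :
    ∫⁻ y, ENNReal.ofReal (g ((μ.map φ).rnDeriv (ν.map φ) y).toReal) ∂(ν.map φ) ≤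
      ∫⁻ x, ENNReal.ofReal (g (μ.rnDeriv ν x).toReal) ∂ν := by
  have hrm : Measurable fun x => (μ.rnDeriv ν x).toReal :=
    (Measure.measurable_rnDeriv μ ν).ennreal_toReal
  have hqm : Measurable fun y => ((μ.map φ).rnDeriv (ν.map φ) y).toReal :=
    (Measure.measurable_rnDeriv _ _).ennreal_toReal
  by_cases htop : ∫⁻ x, ENNReal.ofReal (g (μ.rnDeriv ν x).toReal) ∂ν = ∞
  · exact htop ▸ le_top
  have hi : Integrable (fun x => g (μ.rnDeriv ν x).toReal) ν :=
    (lintegral_ofReal_ne_top_iff_integrable (hgm.comp hrm).aestronglyMeasurable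
      (ae_of_all _ fun x => h0 _)).1 htop
  -- Continuity of g can fail only at 0, so points where the projected density vanishes are treated
  -- separately.
  let B : Set Ω' := {y | ((μ.map φ).rnDeriv (ν.map φ) y).toReal ≠ 0}
  have hB : MeasurableSet B := (hqm (measurableSet_singleton 0)).compl
  have hgq : Measurable fun y =>
      ENNReal.ofReal (g ((μ.map φ).rnDeriv (ν.map φ) y).toReal) := (hgm.comp hqm).ennreal_ofReal
  rw [lintegral_map hgq hφ, ← lintegral_add_compl _ (hφ hB),
    ← lintegral_add_compl (fun x => ENNReal.ofReal (g (μ.rnDeriv ν x).toReal)) (hφ hB)]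
  refine add_le_add ?_ (le_of_eq ?_)
  · let e : ℕ → ℝ := fun k => 1 / ((k : ℝ) + 1)
    have he0 : ∀ k, 0 < e k := fun k => Nat.one_div_pos_of_nat
    have he1 : ∀ k, e k ≤ 1 := fun k => by
      refine (div_le_one (by positivity)).2 ?_
      linarith [(Nat.cast_nonneg k : (0 : ℝ) ≤ k)]
    -- Pulling the argument towards 1 avoids the discontinuity at 0; by convexity and g 1 = 0 this
    -- only lowers g. Fatou's lemma on the preimage of B then recovers g.
    let G : ℕ → ℝ → ℝ := fun k t => g ((1 - e k) * t + e k)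
    have hGm : ∀ k, Measurable (G k) := fun k => hgm.comp (by fun_prop)
    have hmem : ∀ k t, 0 ≤ t → e k ≤ (1 - e k) * t + e k := fun k t ht =>
      le_add_of_nonneg_left (mul_nonneg (sub_nonneg.2 (he1 k)) ht)
    have hGconv : ∀ k, ConvexOn ℝ (Ici 0) (G k) := fun k => by
      refine ⟨convex_Ici 0, fun x hx y hy a b ha hb hab => ?_⟩
      have h := hg.2 (mem_Ici.2 ((he0 k).le.trans (hmem k x hx)))
        (mem_Ici.2 ((he0 k).le.trans (hmem k y hy))) ha hb hab
      convert h using 2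
      simp only [smul_eq_mul]
      linear_combination (-e k) * hab
    have hgc : ∀ t, 0 < t → ContinuousAt g t := fun t ht =>
      (hg.continuousOn_interior).continuousAt (by simpa using Ioi_mem_nhds ht)
    have hGc : ∀ k, ContinuousWithinAt (G k) (Ici 0) 0 := fun k => by
      have h : ContinuousAt g ((1 - e k) * 0 + e k) := hgc _ (by simpa using he0 k)
      exact (ContinuousAt.comp (f := fun t => (1 - e k) * t + e k) h
        (by fun_prop)).continuousWithinAt
    have hGle : ∀ k t, 0 ≤ t → G k t ≤ g t := fun k t ht => by
      have h := hg.2 (mem_Ici.2 ht) (mem_Ici.2 zero_le_one) (sub_nonneg.2 (he1 k)) (he0 k).le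
        (sub_add_cancel _ _)
      simp only [smul_eq_mul, mul_one, h1, mul_zero, add_zero] at h
      exact h.trans (mul_le_of_le_one_left (h0 t) (by linarith [he0 k]))
    have hGi : ∀ k, Integrable (fun x => G k (μ.rnDeriv ν x).toReal) ν := fun k =>
      hi.mono' ((hGm k).comp hrm).aestronglyMeasurable <| ae_of_all _ fun x => by
        rw [Real.norm_eq_abs, abs_of_nonneg (h0 _)]
        exact hGle k _ ENNReal.toReal_nonneg
    have hstep : ∀ k,
        ∫⁻ x in φ ⁻¹' B, ENNReal.ofReal (G k ((μ.map φ).rnDeriv (ν.map φ) (φ x)).toReal) ∂ν ≤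
          ∫⁻ x in φ ⁻¹' B, ENNReal.ofReal (g (μ.rnDeriv ν x).toReal) ∂ν := fun k =>
      (setLIntegral_comp_rnDeriv_map_le (hGm k) (hGconv k) (hGc k) (fun t => h0 _) hμν hφ (hGi k)
        hB).trans (lintegral_mono fun x =>
          ENNReal.ofReal_le_ofReal (hGle k _ ENNReal.toReal_nonneg))
    have hlim : ∀ t, 0 < t →
        Tendsto (fun k => ENNReal.ofReal (G k t)) atTop (𝓝 (ENNReal.ofReal (g t))) := by
      intro t ht
      have he : Tendsto e atTop (𝓝 0) := tendsto_one_div_add_atTop_nhds_zero_nat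
      have h2 : Tendsto (fun k => (1 - e k) * t + e k) atTop (𝓝 t) := by
        simpa using (((tendsto_const_nhds (x := (1 : ℝ))).sub he).mul_const t).add he
      exact (ENNReal.continuous_ofReal.tendsto _).comp ((hgc t ht).tendsto.comp h2)
    calc ∫⁻ x in φ ⁻¹' B, ENNReal.ofReal (g ((μ.map φ).rnDeriv (ν.map φ) (φ x)).toReal) ∂ν
        = ∫⁻ x in φ ⁻¹' B, liminf (fun k =>
            ENNReal.ofReal (G k ((μ.map φ).rnDeriv (ν.map φ) (φ x)).toReal)) atTop ∂ν := by
          refine setLIntegral_congr_fun (hφ hB) fun x hx => ?_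
          exact (hlim _ (ENNReal.toReal_nonneg.lt_of_ne' hx)).liminf_eq.symm
      _ ≤ liminf (fun k => ∫⁻ x in φ ⁻¹' B,
            ENNReal.ofReal (G k ((μ.map φ).rnDeriv (ν.map φ) (φ x)).toReal) ∂ν) atTop :=
          lintegral_liminf_le fun k => (((hGm k).comp hqm).comp hφ).ennreal_ofReal
      _ ≤ ∫⁻ x in φ ⁻¹' B, ENNReal.ofReal (g (μ.rnDeriv ν x).toReal) ∂ν :=
          liminf_le_of_le (by isBoundedDefault) fun b hb =>
            (hb.exists.elim fun k hk => hk.trans (hstep k))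
  -- Off the preimage of B the density dμ/dν has integral zero, so it vanishes almost everywhere and
  -- both integrands equal g 0.
  · have hzero : ∫ x in (φ ⁻¹' B)ᶜ, (μ.rnDeriv ν x).toReal ∂ν = 0 := by
      have hcond := toReal_rnDeriv_map hμν hφ
      rw [← setIntegral_condExp hφ.comap_le Measure.integrable_toReal_rnDeriv
        (s := (φ ⁻¹' B)ᶜ) ⟨Bᶜ, hB.compl, rfl⟩,
        ← setIntegral_congr_ae (hφ hB).compl (hcond.mono fun x hx _ => hx)]
      refine setIntegral_eq_zero_of_forall_eq_zero fun x hx => ?_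
      simpa [B] using hx
    rw [setIntegral_eq_zero_iff_of_nonneg_ae (ae_of_all _ fun x => ENNReal.toReal_nonneg)
      Measure.integrable_toReal_rnDeriv.integrableOn] at hzero
    refine lintegral_congr_ae ?_
    filter_upwards [hzero, ae_restrict_mem (hφ hB).compl] with x hx hxB
    have hq : ((μ.map φ).rnDeriv (ν.map φ) (φ x)).toReal = 0 := by simpa [B] using hxB
    have hr : (μ.rnDeriv ν x).toReal = 0 := hx
    simp only [hq, hr]

end DataProcessing

/-! ### f-divergences. -/

section FDivergence

open Set Filter

variable {m n : ℕ}

/-- Subtracting its tangent at `1` from `f` gives a nonnegative generator of the same divergence. -/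
theorem exists_nonneg_generator {f : ℝ → ℝ} (hf : ConvexOn ℝ (Ici 0) f) (hf1 : f 1 = 0)
    (hne : ¬ ∃ c : ℝ, ∀ᶠ t in 𝓝 (1 : ℝ), f t = c * (t - 1)) :
    ∃ g : ℝ → ℝ, Measurable g ∧ ConvexOn ℝ (Ici 0) g ∧ (∀ t, 0 ≤ g t) ∧ g 1 = 0 ∧
      ((∀ t, 0 ≤ t → t < 1 → 0 < g t) ∨ ∀ t, 1 < t → 0 < g t) ∧
      ∃ c : ℝ, ∀ t, 0 ≤ t → g t = f t - c * (t - 1) := by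
  -- The right derivative at 1 is the slope of a supporting line.
  let c : ℝ := derivWithin f (Ioi 1) 1
  have h1 : (1 : ℝ) ∈ interior (Ici (0 : ℝ)) := by simp
  have htan : ∀ t, 0 ≤ t → c * (t - 1) ≤ f t := by
    intro t ht
    rcases lt_trichotomy t 1 with hlt | rfl | hgt
    · have h := (hf.slope_le_leftDeriv_of_mem_interior (mem_Ici.2 ht) h1 hlt).trans
        (hf.leftDeriv_le_rightDeriv_of_mem_interior h1)
      rw [slope_def_field, hf1, div_le_iff₀ (sub_pos.2 hlt)] at h
      change _ ≤ c * _ at h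
      linarith
    · simp [hf1]
    · have h := hf.rightDeriv_le_slope_of_mem_interior h1 (mem_Ici.2 ht) hgt
      rw [slope_def_field, hf1, le_div_iff₀ (sub_pos.2 hgt)] at h
      change c * _ ≤ _ at h
      linarith
  let g : ℝ → ℝ := fun t => f (max t 0) - c * (max t 0 - 1)
  have hg : ∀ t, 0 ≤ t → g t = f t - c * (t - 1) := fun t ht => by simp [g, ht]
  have hconv : ConvexOn ℝ (Ici 0) g := by
    have hlin : ConcaveOn ℝ (Ici (0 : ℝ)) fun t => c * (t - 1) :=
      ⟨convex_Ici 0, fun x _ y _ a b _ _ hab => by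
        simp only [smul_eq_mul]
        linear_combination (-c) * hab⟩
    exact (hf.sub hlin).congr fun t ht => (hg t ht).symm
  have hpos : ∀ t, 0 ≤ g t := fun t => sub_nonneg.2 (htan _ (le_max_right _ _))
  have hg1 : g 1 = 0 := by simp [g, hf1]
  refine ⟨g, ?_, hconv, hpos, hg1, ?_, c, hg⟩
  · have hfm : Measurable fun t => f (max t 0) := by
      have hcont : ContinuousOn (fun t => f (max t 0)) (Ioi 0) := by
        have := hf.continuousOn_interior
        rw [interior_Ici] at this
        exact this.congr fun t ht => by simp [(mem_Ioi.1 ht).le]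
      have h := hcont.measurable_piecewise (g := fun _ => f 0) continuousOn_const measurableSet_Ioi
      convert h using 1
      funext t
      by_cases ht : 0 < t
      · simp [Set.piecewise, ht]
      · simp [Set.piecewise, ht, not_lt.1 ht]
    exact hfm.sub (by fun_prop)
  -- Zeros of g on both sides of 1 would make the nonnegative convex g vanish between them, so f
  -- would be affine near 1.
  · by_contra! hcon
    obtain ⟨⟨a, ha0, ha1, ha⟩, b, hb1, hb⟩ := hcon
    refine hne ⟨c, ?_⟩
    filter_upwards [Ioo_mem_nhds ha1 hb1] with t ht
    have ht0 : 0 ≤ t := ha0.trans ht.1.le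
    have hmax := hconv.le_max_of_mem_Icc (mem_Ici.2 ha0)
      (mem_Ici.2 (ha0.trans (ha1.trans hb1).le)) (z := t) ⟨ht.1.le, ht.2.le⟩
    have hz : g t = 0 := le_antisymm (hmax.trans (max_le ha hb)) (hpos t)
    rw [hg t ht0] at hz
    linarith

/-- The subtracted linear term has integral zero, since both measures are probabilities. The
divergence becomes a lower integral, with no integrability condition left. -/
theorem fDiv_eq_lintegral {f g : ℝ → ℝ} (hgm : Measurable g) (h0 : ∀ t, 0 ≤ g t) {c : ℝ}
    (hc : ∀ t, 0 ≤ t → g t = f t - c * (t - 1)) {μ ν : Measure (E n)} [IsProbabilityMeasure μ]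
    [IsProbabilityMeasure ν] (hμν : μ ≪ ν) :
    fDiv f μ ν = ((∫⁻ x, ENNReal.ofReal (g (μ.rnDeriv ν x).toReal) ∂ν : ℝ≥0∞) : EReal) := by
  have hrm : Measurable fun x => (μ.rnDeriv ν x).toReal :=
    (Measure.measurable_rnDeriv μ ν).ennreal_toReal
  have hri : Integrable (fun x => (μ.rnDeriv ν x).toReal) ν := Measure.integrable_toReal_rnDeriv
  have hli : Integrable (fun x => c * ((μ.rnDeriv ν x).toReal - 1)) ν :=
    (hri.sub (integrable_const _)).const_mul c
  have hfg : (fun x => f (μ.rnDeriv ν x).toReal) =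
      fun x => g (μ.rnDeriv ν x).toReal + c * ((μ.rnDeriv ν x).toReal - 1) := by
    funext x
    rw [hc _ ENNReal.toReal_nonneg]
    ring
  have hiff := lintegral_ofReal_ne_top_iff_integrable (hgm.comp hrm).aestronglyMeasurable
    (ae_of_all ν fun x => h0 (μ.rnDeriv ν x).toReal)
  have hiff' : Integrable (fun x => f (μ.rnDeriv ν x).toReal) ν ↔
      Integrable (fun x => g (μ.rnDeriv ν x).toReal) ν := by
    rw [hfg]
    exact integrable_add_iff_integrable_left hli
  by_cases hi : Integrable (fun x => g (μ.rnDeriv ν x).toReal) ν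
  · have hint : ∫ x, f (μ.rnDeriv ν x).toReal ∂ν = ∫ x, g (μ.rnDeriv ν x).toReal ∂ν := by
      rw [hfg, integral_add hi hli, integral_const_mul, integral_sub hri (integrable_const _),
        Measure.integral_toReal_rnDeriv hμν]
      simp
    rw [fDiv, if_pos ⟨hμν, hiff'.2 hi⟩, hint,
      ← ofReal_integral_eq_lintegral_ofReal hi (ae_of_all _ fun x => h0 _),
      EReal.coe_ennreal_ofReal, max_eq_left (integral_nonneg fun x => h0 _)]
  · have htop : ∫⁻ x, ENNReal.ofReal (g (μ.rnDeriv ν x).toReal) ∂ν = ∞ := by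
      by_contra h
      exact hi (hiff.1 h)
    rw [fDiv, if_neg fun h => hi (hiff'.1 h.2), htop]
    rfl

theorem fDiv_of_not_ac {f : ℝ → ℝ} {μ ν : Measure (E n)} (h : ¬ μ ≪ ν) : fDiv f μ ν = ⊤ :=
  if_neg fun h' => h h'.1

theorem fDiv_self {f : ℝ → ℝ} (hf1 : f 1 = 0) (μ : Measure (E n)) [IsProbabilityMeasure μ] :
    fDiv f μ μ = 0 := by
  have h : (fun x => f (μ.rnDeriv μ x).toReal) =ᵐ[μ] fun _ => 0 := by
    filter_upwards [μ.rnDeriv_self] with x hx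
    simp [hx, hf1]
  rw [fDiv, if_pos ⟨Measure.AbsolutelyContinuous.rfl,
    (integrable_congr h).2 (integrable_const _)⟩, integral_congr_ae h]
  simp

theorem map_withDensity_comp {Ω Ω' : Type*} [MeasurableSpace Ω] [MeasurableSpace Ω']
    (ν : Measure Ω) {φ : Ω → Ω'} (hφ : Measurable φ) {r : Ω' → ℝ≥0∞} (hr : Measurable r) :
    (ν.withDensity (r ∘ φ)).map φ = (ν.map φ).withDensity r := by
  ext s hs
  rw [Measure.map_apply hφ hs, withDensity_apply _ (hφ hs), withDensity_apply _ hs,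
    setLIntegral_map hs hr hφ]
  rfl

theorem mem_probsDensity_of_ac {α ν : Measure (E n)} [IsProbabilityMeasure α] (h : α ≪ ν)
    (hν : ν ∈ probsPosDensity n) : α ∈ probsDensity n := by
  obtain ⟨-, g, -, -, rfl⟩ := hν
  have hac : α ≪ (volume : Measure (E n)) := h.trans (withDensity_absolutelyContinuous _ _)
  refine ⟨‹_›, fun x => (α.rnDeriv volume x).toNNReal,
    (Measure.measurable_rnDeriv α volume).ennreal_toNNReal, ?_⟩
  conv_lhs => rw [← Measure.withDensity_rnDeriv_eq α volume hac]
  refine withDensity_congr_ae ?_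
  filter_upwards [Measure.rnDeriv_ne_top α volume] with x hx
  exact (ENNReal.coe_toNNReal hx).symm

theorem fDiv_dist_eq {f : ℝ → ℝ} (hf : ConvexOn ℝ (Ici 0) f) (hf1 : f 1 = 0)
    (hne : ¬ ∃ c : ℝ, ∀ᶠ t in 𝓝 (1 : ℝ), f t = c * (t - 1)) {μ : Measure (E m)}
    {ν : Measure (E n)} (hμ : μ ∈ probsDensity m) (hν : ν ∈ probsPosDensity n) :
    projDist (fDiv f) μ ν = embDist (fDiv f) (probsDensity n) μ ν ∧
      (projDist (fDiv f) μ ν = 0 ↔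
        ∃ V ∈ stiefel m n, ∃ b : E m, ν.map (affineProj V b) = μ) := by
  have := hμ.1
  have := hν.1
  obtain ⟨g, hgm, hgc, h0, h1, hside, c, hc⟩ := exists_nonneg_generator hf hf1 hne
  have hprob : ∀ V b, IsProbabilityMeasure (ν.map (affineProj (m := m) V b)) := fun V b =>
    Measure.isProbabilityMeasure_map (measurable_affineProj V b).aemeasurable
  refine ⟨projDist_eq_embDist (fun α hα V hV b => ?_) fun V hV b => ?_,
    projDist_eq_zero_iff (fun β hβ => ?_) (fDiv_self hf1 μ) fun ε hε => ?_⟩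
  · have := hα.1
    have hφ := measurable_affineProj V b
    have := hprob V b
    have := Measure.isProbabilityMeasure_map (μ := α) hφ.aemeasurable
    by_cases hac : α ≪ ν
    · rw [fDiv_eq_lintegral hgm h0 hc hac, fDiv_eq_lintegral hgm h0 hc (hac.map hφ)]
      exact_mod_cast lintegral_comp_rnDeriv_map_le hgm hgc h0 h1 hac hφ
    · rw [fDiv_of_not_ac hac]
      exact le_top
  · have hφ := measurable_affineProj V b
    have := hprob V b
    by_cases hac : μ ≪ ν.map (affineProj V b)
    · let r := μ.rnDeriv (ν.map (affineProj V b))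
      have hr : Measurable r := Measure.measurable_rnDeriv _ _
      -- The density of α relative to ν is constant on fibres of φ, so no divergence is gained over
      -- that of μ from φ(ν).
      let α : Measure (E n) := ν.withDensity (r ∘ affineProj V b)
      have hαμ : α.map (affineProj V b) = μ := by
        rw [map_withDensity_comp ν hφ hr]
        have := Measure.haveLebesgueDecomposition_of_sigmaFinite μ (ν.map (affineProj V b))
        exact Measure.withDensity_rnDeriv_eq μ (ν.map (affineProj V b)) hac
      have hα : IsProbabilityMeasure α := by
        constructor
        rw [← Set.preimage_univ (f := affineProj V b), ← Measure.map_apply hφ MeasurableSet.univ,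
          hαμ, measure_univ]
      have hαν : α ≪ ν := withDensity_absolutelyContinuous _ _
      refine (iInf₂_le α ⟨mem_probsDensity_of_ac hαν hν, V, hV, b, hαμ⟩).trans (le_of_eq ?_)
      have hgr : Measurable fun y =>
          ENNReal.ofReal (g (μ.rnDeriv (ν.map (affineProj V b)) y).toReal) :=
        (hgm.comp hr.ennreal_toReal).ennreal_ofReal
      rw [fDiv_eq_lintegral hgm h0 hc hαν, fDiv_eq_lintegral hgm h0 hc hac,
        lintegral_map hgr hφ]
      congr 1
      refine lintegral_congr_ae ?_
      filter_upwards [Measure.rnDeriv_withDensity ν (hr.comp hφ)] with x hx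
      rw [hx]
      rfl
    · rw [fDiv_of_not_ac hac]
      exact le_top
  · have : IsProbabilityMeasure β := hβ
    by_cases hac : μ ≪ β
    · rw [fDiv_eq_lintegral hgm h0 hc hac]
      exact EReal.coe_ennreal_nonneg _
    · rw [fDiv_of_not_ac hac]
      exact le_top
  · obtain ⟨δ, hδ, hd⟩ := exists_forall_abs_integral_sub_le hgm hgc h0 h1 hside hε
    refine ⟨δ, EReal.coe_ennreal_pos.2 hδ, fun β hβ hlt k hk hk01 => ?_⟩
    have : IsProbabilityMeasure β := hβ
    by_cases hac : μ ≪ β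
    · rw [fDiv_eq_lintegral hgm h0 hc hac, EReal.coe_ennreal_lt_coe_ennreal_iff] at hlt
      exact hd μ β hac hlt k hk.continuous.measurable hk01
    · rw [fDiv_of_not_ac hac] at hlt
      exact absurd hlt not_top_lt

end FDivergence

end AugDist

/-- The projection distance and the embedding distance agree, and their common value is zero exactly
if `μ` is the image of `ν` under `x ↦ V x + b` for some `V ∈ O(m,n)`, `b ∈ ℝᵐ`; for the
`p`-Wasserstein, Jensen--Shannon and total variation distances and for `f`-divergences. -/
theorem corollary1p3 (m n : ℕ) (hmn : m ≤ n) :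
    (∀ p : ℝ≥0∞, 1 ≤ p →
      ∀ μ ∈ AugDist.probsMoment p m, ∀ ν ∈ AugDist.probsMoment p n,
        AugDist.projDist (AugDist.wasserstein p) μ ν =
            AugDist.embDist (AugDist.wasserstein p) (AugDist.probsMoment p n) μ ν ∧
          (AugDist.projDist (AugDist.wasserstein p) μ ν = 0 ↔
            ∃ V ∈ AugDist.stiefel m n, ∃ b : AugDist.E m,
              ν.map (AugDist.affineProj V b) = μ)) ∧
    (∀ θ : ℝ, 0 < θ → θ < 1 →
      ∀ μ ∈ AugDist.probs m, ∀ ν ∈ AugDist.probs n,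
        AugDist.projDist (AugDist.jsDiv θ) μ ν =
            AugDist.embDist (AugDist.jsDiv θ) (AugDist.probs n) μ ν ∧
          (AugDist.projDist (AugDist.jsDiv θ) μ ν = 0 ↔
            ∃ V ∈ AugDist.stiefel m n, ∃ b : AugDist.E m,
              ν.map (AugDist.affineProj V b) = μ)) ∧
    (∀ μ ∈ AugDist.probs m, ∀ ν ∈ AugDist.probs n,
        AugDist.projDist AugDist.tvDist μ ν =
            AugDist.embDist AugDist.tvDist (AugDist.probs n) μ ν ∧
          (AugDist.projDist AugDist.tvDist μ ν = 0 ↔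
            ∃ V ∈ AugDist.stiefel m n, ∃ b : AugDist.E m,
              ν.map (AugDist.affineProj V b) = μ)) ∧
    (∀ f : ℝ → ℝ, ConvexOn ℝ (Set.Ici 0) f → f 1 = 0 →
      (¬ ∃ c : ℝ, ∀ᶠ t in 𝓝 (1 : ℝ), f t = c * (t - 1)) →
      ∀ μ ∈ AugDist.probsDensity m, ∀ ν ∈ AugDist.probsPosDensity n,
        AugDist.projDist (AugDist.fDiv f) μ ν =
            AugDist.embDist (AugDist.fDiv f) (AugDist.probsDensity n) μ ν ∧
          (AugDist.projDist (AugDist.fDiv f) μ ν = 0 ↔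
            ∃ V ∈ AugDist.stiefel m n, ∃ b : AugDist.E m,
              ν.map (AugDist.affineProj V b) = μ)) := by
  exact ⟨fun p hp μ hμ ν hν => AugDist.wasserstein_dist_eq hp hμ hν,
    fun θ h0 h1 μ hμ ν hν => AugDist.jsDiv_dist_eq h0 h1 hμ hν,
    fun μ hμ ν hν => AugDist.tvDist_dist_eq hμ hν,
    fun f hf hf1 hne μ hμ ν hν => AugDist.fDiv_dist_eq hf hf1 hne hμ hν⟩
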